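/- Let $(X_t)_{t\in\mathbb{R}}$ be a stationary Markov process on a probability space $(\Omega,\mathcal F,\mathbf P)$ with càdlàg sample paths in a Polish space $E$, and let $\pi$ be the law of $X_0$. Let $(B_t)_{t\in\mathbb{R}}$ be an $n$-dimensional two-sided Wiener process on the same space, independent of $(X_t)_{t\in\mathbb{R}}$. Let $h:E\to\mathbb{R}^n$ be measurable and such that, almost surely, $s\mapsto h(X_s)$ is locally integrable on $\mathbb{R}$. For $\kappa>0$ put $$Y^\kappa_t=\int_0^t h(X_s)\,ds+\kappa B_t\qquad(t\in\mathbb{R}).$$ Write $\mathcal F^{h(X)}_{I}=\sigma\{h(X_s):s\in I\}$ for $I\subset\mathbb{R}$, and $$\mathcal F^{Y,\kappa}_{]-\infty,0]}=\bigvee_{a<0}\sigma\{Y^\kappa_s-Y^\kappa_a: s\in[a,0]\}.$$ For $f\in L^2(\pi)$ let $$e(f,\kappa)=\mathbf E\Big(\big\{f(X_0)-\mathbf E\big(f(X_0)\,\big|\,\mathcal F^{Y,\kappa}_{]-\infty,0]}\big)\big\}^2\Big)$$ be the stationary filtering error. For a probability measure $\mu\ll\pi$ on $E$ let $\mathbf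 P^\mu(A)=\mathbf E\big(I_A\,\tfrac{d\mu}{d\pi}(X_0)\big)$. **Theorem 3.1.** The following conditions are equivalent: 1. (The filter achieves maximal accuracy.) For every $f\in L^2(\pi)$, $e(f,\kappa)\to0$ as $\kappa\downarrow0$. 2. (The model is stably invertible.) For every $t\in\mathbb{R}$, $X_t$ coincides $\mathbf P$-a.s. with an $\mathcal F^{h(X)}_{]-\infty,t]}$-measurable random variable. 3. (The model is strongly reconstructible.) For all probability measures $\mu,\nu\ll\pi$ with $\mu\perp\nu$, the restrictions of $\mathbf P^\mu$ and $\mathbf P^\nu$ to $\mathcal F^{h(X)}_{]-\infty,0]}$ are mutually singular. Moreover, any one of these conditions implies both of the following: 4. (The model is invertible.) For all $s\le t$, $X_t$ coincides $\mathbf P$-a.s. with a $\sigma(X_s)\vee\mathcal F^{h(X)}_{[s,t]}$-measurable random variable. 5. (The model is reconstructible.) For all probability measures $\mu,\nu\ll\pi$ with $\mu\neq\nu$, the restrictions of $\mathbf P^\mu$ and $\mathbf P^\nu$ to $\mathcal F^{h(X)}_{]-\infty,0]}$ are different. -/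

import Mathlib

open MeasureTheory ProbabilityTheory Filter Topology

namespace MaxAccuracy

/-- The sigma-field `σ{Z_s : s ∈ I}` generated by the variables of a process `Z` with time in `I`. -/
def sigmaOn {Ω F : Type*} [MeasurableSpace F] (Z : ℝ → Ω → F) (I : Set ℝ) : MeasurableSpace Ω :=
  ⨆ s ∈ I, MeasurableSpace.comap (Z s) inferInstance

section Processes

variable {Ω : Type*} [MeasurableSpace Ω]

lemma sigmaOn_le {F : Type*} [MeasurableSpace F] {Z : ℝ → Ω → F} (hZ : ∀ t, Measurable (Z t))
    (I : Set ℝ) : sigmaOn Z I ≤ ‹MeasurableSpace Ω› :=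
  iSup₂_le fun s _ => (hZ s).comap_le

/-- A path indexed by `ℝ` which is right continuous with left limits. -/
def IsCadlag {E : Type*} [TopologicalSpace E] (x : ℝ → E) : Prop :=
  ∀ t, ContinuousWithinAt x (Set.Ici t) t ∧ ∃ l, Tendsto x (𝓝[<] t) (𝓝 l)

/-- (Strict) stationarity: the law of the whole process, as a measure on the product space
`ℝ → E`, is invariant under time shifts. -/
def IsStationary {E : Type*} [MeasurableSpace E] (X : ℝ → Ω → E) (P : Measure Ω) : Prop :=
  ∀ r : ℝ, P.map (fun ω t => X (t + r) ω) = P.map (fun ω t => X t ω)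

/-- The Markov property: for `s ≤ t` and bounded measurable `f`,
`E(f(X_t) | σ{X_r : r ≤ s}) = E(f(X_t) | σ(X_s))` almost surely. -/
def IsMarkov {E : Type*} [MeasurableSpace E] (X : ℝ → Ω → E) (P : Measure Ω) : Prop :=
  ∀ s t : ℝ, s ≤ t → ∀ f : E → ℝ, Measurable f → (∃ C, ∀ x, |f x| ≤ C) →
    P[fun ω => f (X t ω) | sigmaOn X (Set.Iic s)]
      =ᵐ[P] P[fun ω => f (X t ω) | MeasurableSpace.comap (X s) inferInstance]

/-- An `n`-dimensional two-sided Wiener process `(B_t)_{t ∈ ℝ}`: it vanishes at time `0`, has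
independent increments over successive intervals of `ℝ`, `B_t - B_s` is centred Gaussian with
covariance `(t - s) I` for `s ≤ t`, and its paths are almost surely continuous. -/
structure IsTwoSidedWiener {n : ℕ} (B : ℝ → Ω → EuclideanSpace ℝ (Fin n)) (P : Measure Ω) :
    Prop where
  measurable : ∀ t, Measurable (B t)
  zero : ∀ᵐ ω ∂P, B 0 ω = 0
  indep_increments : HasIndepIncrements B P
  gaussian_increments : ∀ s t : ℝ, s ≤ t →
    P.map (fun ω => B t ω - B s ω)
      = multivariateGaussian 0 ((t - s) • (1 : Matrix (Fin n) (Fin n) ℝ))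
  continuous_paths : ∀ᵐ ω ∂P, Continuous fun t => B t ω

end Processes

/-- A filtering model: a stationary càdlàg Markov signal `X` with values in `E`, an observation
function `h : E → ℝⁿ` for which the time integral of `h(X)` exists, and an independent
`n`-dimensional two-sided Wiener process `B`, all on one probability space. -/
structure FilteringModel (Ω E : Type*) [MeasurableSpace Ω] [TopologicalSpace E]
    [MeasurableSpace E] (n : ℕ) where
  P : Measure Ω
  X : ℝ → Ω → E
  B : ℝ → Ω → EuclideanSpace ℝ (Fin n)
  h : E → EuclideanSpace ℝ (Fin n)
  isProbabilityMeasure : IsProbabilityMeasure P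
  measurable_X : ∀ t, Measurable (X t)
  cadlag : ∀ ω, IsCadlag fun t => X t ω
  stationary : IsStationary X P
  markov : IsMarkov X P
  wiener : IsTwoSidedWiener B P
  indep : IndepFun (fun ω t => X t ω) (fun ω t => B t ω) P
  measurable_h : Measurable h
  locallyIntegrable : ∀ᵐ ω ∂P, LocallyIntegrable (fun s => h (X s ω)) volume

namespace FilteringModel

variable {Ω E : Type*} [MeasurableSpace Ω] [TopologicalSpace E] [MeasurableSpace E] {n : ℕ}

/-- The stationary measure `π`, i.e. the law of `X_0`. -/
noncomputable def stationaryLaw (M : FilteringModel Ω E n) : Measure E :=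
  M.P.map (M.X 0)

/-- The observation process `Y_t^κ = ∫_0^t h(X_s) ds + κ B_t`. -/
noncomputable def Y (M : FilteringModel Ω E n) (κ t : ℝ) (ω : Ω) : EuclideanSpace ℝ (Fin n) :=
  (∫ s in (0 : ℝ)..t, M.h (M.X s ω)) + κ • M.B t ω

/-- The sigma-field `σ{h(X_s) : s ∈ I}` of the noiseless observations. -/
def sigmaHX (M : FilteringModel Ω E n) (I : Set ℝ) : MeasurableSpace Ω :=
  sigmaOn (fun s ω => M.h (M.X s ω)) I

lemma sigmaHX_le (M : FilteringModel Ω E n) (I : Set ℝ) :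
    M.sigmaHX I ≤ ‹MeasurableSpace Ω› :=
  sigmaOn_le (fun t => M.measurable_h.comp (M.measurable_X t)) I

/-- The sigma-field `σ{Y_s^κ - Y_a^κ : s ∈ [a, b]}`. -/
noncomputable def sigmaY (M : FilteringModel Ω E n) (κ a b : ℝ) : MeasurableSpace Ω :=
  sigmaOn (fun s ω => M.Y κ s ω - M.Y κ a ω) (Set.Icc a b)

/-- The sigma-field of all observations up to time `b`, the join over `a < b` of
`σ{Y_s^κ - Y_a^κ : s ∈ [a, b]}`. -/
noncomputable def sigmaYPast (M : FilteringModel Ω E n) (κ b : ℝ) : MeasurableSpace Ω :=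
  ⨆ a ∈ Set.Iio b, M.sigmaY κ a b

/-- The stationary mean square filtering error
`e(f, κ) = E({f(X_0) - E(f(X_0) | observations up to time 0)}²)`. -/
noncomputable def stationaryError (M : FilteringModel Ω E n) (f : E → ℝ) (κ : ℝ) : ℝ :=
  ∫ ω, (f (M.X 0 ω) - (M.P[fun ω' => f (M.X 0 ω') | M.sigmaYPast κ 0]) ω) ^ 2 ∂M.P

/-- Maximal accuracy: `e(f, κ) → 0` as `κ ↓ 0` for every `f ∈ L²(π)`. -/
def AchievesMaximalAccuracy (M : FilteringModel Ω E n) : Prop :=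
  ∀ f : E → ℝ, MemLp f 2 M.stationaryLaw →
    Tendsto (fun κ => M.stationaryError f κ) (𝓝[>] 0) (𝓝 0)

/-- For `μ ≪ π`, the measure `P^μ` with density `(dμ/dπ)(X_0)` with respect to `P`. -/
noncomputable def Pμ (M : FilteringModel Ω E n) (μ : Measure E) : Measure Ω :=
  M.P.withDensity fun ω => μ.rnDeriv M.stationaryLaw (M.X 0 ω)

/-- The restriction of `P^μ` to the sigma-field `σ{h(X_s) : s ≤ 0}`. -/
noncomputable def pastLaw (M : FilteringModel Ω E n) (μ : Measure E) :
    @Measure Ω (M.sigmaHX (Set.Iic 0)) :=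
  (M.Pμ μ).trim (M.sigmaHX_le (Set.Iic 0))

/-- Distinct probability measures `μ, ν ≪ π` give distinct laws of the past noiseless
observations. -/
def Reconstructible (M : FilteringModel Ω E n) : Prop :=
  ∀ μ ν : Measure E, IsProbabilityMeasure μ → IsProbabilityMeasure ν →
    μ ≪ M.stationaryLaw → ν ≪ M.stationaryLaw → μ ≠ ν → M.pastLaw μ ≠ M.pastLaw ν

/-- Mutually singular probability measures `μ, ν ≪ π` give mutually singular laws of the past
noiseless observations (singular on the sigma-field `σ{h(X_s) : s ≤ 0}`). -/
def StronglyReconstructible (M : FilteringModel Ω E n) : Prop :=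
  ∀ μ ν : Measure E, IsProbabilityMeasure μ → IsProbabilityMeasure ν →
    μ ≪ M.stationaryLaw → ν ≪ M.stationaryLaw → μ ⟂ₘ ν →
      Measure.MutuallySingular (M.pastLaw μ) (M.pastLaw ν)

/-- For all `s ≤ t`, `X_t` is almost surely equal to a random variable which is measurable with
respect to `σ(X_s) ∨ σ{h(X_r) : r ∈ [s, t]}`. -/
def Invertible (M : FilteringModel Ω E n) : Prop :=
  ∀ s t : ℝ, s ≤ t → ∃ Z : Ω → E,
    Measurable[MeasurableSpace.comap (M.X s) inferInstance ⊔ M.sigmaHX (Set.Icc s t)] Z ∧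
      M.X t =ᵐ[M.P] Z

/-- For all `t`, `X_t` is almost surely equal to a random variable which is measurable with
respect to `σ{h(X_r) : r ≤ t}`. -/
def StablyInvertible (M : FilteringModel Ω E n) : Prop :=
  ∀ t : ℝ, ∃ Z : Ω → E, Measurable[M.sigmaHX (Set.Iic t)] Z ∧ M.X t =ᵐ[M.P] Z

end FilteringModel

end MaxAccuracy

/-!
Everything is reduced to a statement about events: `X` is stably invertible iff every event
`{X_0 ∈ A}` agrees almost surely with an event of `𝓗 = σ{h(X_s) : s ≤ 0}`. That time `0` suffices
follows from stationarity (`exists_ae_eq_of_zero`), and passing from events to variables is possible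
because `E` is standard Borel (`exists_measurable_ae_eq`).

*Stable invertibility gives maximal accuracy.* Call an event recoverable if it is approximated in
probability, as `κ ↓ 0`, by events of the noisy observations up to time `0`. The recoverable events
form a sigma-field (`approxSigma`, here `limitSigma`) which is closed under almost sure limits. The
increments of `Y^κ` converge to `∫_a^b h(X_s) ds`, so these integrals are measurable for it. By
Lebesgue's differentiation theorem so is `h(X_u)` for almost every `u < 0`, and then for every
`u ≤ 0`, since the events `{X_u ∈ A}` depend continuously on `u` (`tendsto_measure_symmDiff`). Hence
all of `𝓗` is recoverable (`sigmaHX_le_limitSigma`), and with it `X_0`. As the conditional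
expectation is the best `L²` approximation, the filtering error of `f(X_0)` tends to zero, for
indicators `f` and then, by density, for all `f ∈ L²(π)`.

*Maximal accuracy gives stable invertibility.* For each `κ` the noisy observations are, up to null
sets, functions of the noise and of `𝓗` (`sigmaYPast_le_approxSigma`; the time integral of an
adapted process is measurable by `ae_eq_condExp_integral_of_bounded`). So if the error vanishes in
the limit, then `{X_0 ∈ A}` agrees almost surely with an event of `σ(B) ∨ 𝓗`. The noise is
independent of the signal, so it can be dropped (`exists_ae_eq_of_condIndep`).

*Stable invertibility and strong reconstructibility.* A set `A` with `μ(A) = 0 = ν(Aᶜ)` yields an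
event of `𝓗` which separates the past laws; conversely, an event separating the past laws started
from `π(· | A)` and `π(· | Aᶜ)` is a version of `{X_0 ∈ Aᶜ}`. Reconstructibility is as direct.

*Invertibility.* Under stable invertibility `X_t` is almost surely a function of the signal up to
time `s` and of `h(X)` on `[s, t]`. Given `X_s`, the signal before `s` is independent of the one
after `s` (`condExp_past_eq`), so it can be replaced by `X_s`, by `exists_ae_eq_of_condIndep` again.
-/

namespace MaxAccuracy

open scoped ENNReal symmDiff

/-! ### Sigma-fields of asymptotically recoverable events -/

section Approximation

variable {Ω ι : Type*} [mΩ : MeasurableSpace Ω]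

/-- The sigma-field of the events that are, along the filter `l`, asymptotically events of the
sigma-fields `F i`: for every `ε > 0`, the event agrees with some event of `F i` up to
probability `ε`, for all `i` far enough along `l`. It is complete, in that it contains all
measurable null sets. -/
def approxSigma (P : Measure Ω) [IsFiniteMeasure P] (l : Filter ι)
    (F : ι → MeasurableSpace Ω) : MeasurableSpace Ω where
  MeasurableSet' A := MeasurableSet A ∧
    ∀ ε : ℝ≥0∞, ε ≠ 0 → ∀ᶠ i in l, ∃ S, MeasurableSet[F i] S ∧ P (A ∆ S) ≤ ε
  measurableSet_empty := ⟨.empty, fun ε _ => .of_forall fun i =>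
    ⟨∅, @MeasurableSet.empty _ (F i), by simp⟩⟩
  measurableSet_compl A hA := ⟨hA.1.compl, fun ε hε => (hA.2 ε hε).mono fun i ⟨S, hS, h⟩ =>
    ⟨Sᶜ, MeasurableSet.compl (m := F i) hS, by rwa [compl_symmDiff_compl]⟩⟩
  measurableSet_iUnion A hA := by
    have hm : MeasurableSet (⋃ i, A i) := .iUnion fun i => (hA i).1
    refine ⟨hm, fun ε hε => ?_⟩
    -- A finite union carries the whole event up to `ε / 2`; its `N` pieces cost `ε / 2` together.
    obtain ⟨N, hN⟩ : ∃ N, P ((⋃ i, A i) \ Set.accumulate A N) ≤ ε / 2 := by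
      have h1 : Tendsto (fun N => P ((⋃ i, A i) \ Set.accumulate A N)) atTop (𝓝 0) := by
        have := tendsto_measure_iInter_atTop (μ := P)
          (s := fun N => (⋃ i, A i) \ Set.accumulate A N)
          (fun N => (hm.diff (.biUnion (Set.to_countable _) fun i _ => (hA i).1)).nullMeasurableSet)
          (fun a b hab => Set.sdiff_subset_sdiff_right (Set.monotone_accumulate hab))
          ⟨0, measure_ne_top _ _⟩
        rwa [← Set.sdiff_iUnion, Set.iUnion_accumulate, Set.sdiff_self, measure_empty] at this
      exact ((ENNReal.tendsto_nhds_zero.1 h1 (ε / 2)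
        (ENNReal.half_pos hε)).exists)
    have h2 : ∀ᶠ i in l, ∀ k ∈ Finset.range (N + 1), ∃ S, MeasurableSet[F i] S ∧
        P (A k ∆ S) ≤ ε / 2 / (N + 1 : ℕ) := by
      rw [Filter.eventually_all_finset]
      exact fun k _ => (hA k).2 _ (ENNReal.div_ne_zero.2
        ⟨(ENNReal.half_pos hε).ne', ENNReal.natCast_ne_top _⟩)
    filter_upwards [h2] with i hi
    choose! S hS hPS using hi
    refine ⟨⋃ k ∈ Finset.range (N + 1), S k, Finset.measurableSet_biUnion _ hS, ?_⟩
    have hsub : (⋃ i, A i) ∆ (⋃ k ∈ Finset.range (N + 1), S k) ⊆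
        ((⋃ i, A i) \ Set.accumulate A N) ∪ ⋃ k ∈ Finset.range (N + 1), A k ∆ S k := by
      intro ω hω
      simp only [Set.mem_symmDiff, Set.mem_union, Set.mem_iUnion, Set.mem_sdiff,
        Set.mem_accumulate, Finset.mem_range, exists_prop, Nat.lt_succ_iff] at hω ⊢
      grind
    calc _ ≤ P ((⋃ i, A i) \ Set.accumulate A N) +
          P (⋃ k ∈ Finset.range (N + 1), A k ∆ S k) :=
            (measure_mono hsub).trans (measure_union_le _ _)
      _ ≤ ε / 2 + ∑ k ∈ Finset.range (N + 1), ε / 2 / (N + 1 : ℕ) := by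
          gcongr
          exact (measure_biUnion_finset_le _ _).trans (Finset.sum_le_sum hPS)
      _ = ε := by
          rw [Finset.sum_const, Finset.card_range, nsmul_eq_mul, ENNReal.mul_div_cancel
            (by simp) (ENNReal.natCast_ne_top _), ENNReal.add_halves]

variable {P : Measure Ω} [IsFiniteMeasure P] {l : Filter ι} {F : ι → MeasurableSpace Ω}

lemma measurableSet_approxSigma_iff {A : Set Ω} :
    MeasurableSet[approxSigma P l F] A ↔ MeasurableSet A ∧
      ∀ ε : ℝ≥0∞, ε ≠ 0 → ∀ᶠ i in l, ∃ S, MeasurableSet[F i] S ∧ P (A ∆ S) ≤ ε :=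
  Iff.rfl

lemma approxSigma_le : approxSigma P l F ≤ mΩ := fun _ hA => hA.1

/-- `approxSigma` is closed under approximation in probability. -/
lemma approxSigma_const_approxSigma_le :
    approxSigma P (⊤ : Filter Unit) (fun _ => approxSigma P l F) ≤ approxSigma P l F := by
  intro A hA
  refine ⟨hA.1, fun ε hε => ?_⟩
  obtain ⟨_, S, hS, hAS⟩ := (hA.2 (ε / 2) (ENNReal.half_pos hε).ne').exists
  filter_upwards [(measurableSet_approxSigma_iff.1 hS).2 (ε / 2)
    (ENNReal.half_pos hε).ne'] with i ⟨T, hT, hST⟩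
  refine ⟨T, hT, ?_⟩
  calc P (A ∆ T) ≤ P (A ∆ S ∪ S ∆ T) := measure_mono (symmDiff_triangle A S T)
    _ ≤ ε / 2 + ε / 2 := (measure_union_le _ _).trans (add_le_add hAS hST)
    _ = ε := ENNReal.add_halves ε

lemma measurableSet_approxSigma_of_ae_eq {A S : Set Ω} (hA : MeasurableSet A)
    (hS : MeasurableSet[approxSigma P l F] S) (h : A =ᵐ[P] S) :
    MeasurableSet[approxSigma P l F] A := by
  refine approxSigma_const_approxSigma_le A ⟨hA, fun ε _ => .of_forall fun _ => ⟨S, hS, ?_⟩⟩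
  rw [measure_symmDiff_eq_zero_iff.2 h]
  exact zero_le

lemma le_approxSigma {m : MeasurableSpace Ω} (hm : m ≤ mΩ)
    (h : ∀ i, m ≤ F i) : m ≤ approxSigma (mΩ := mΩ) P l F :=
  fun A hA => ⟨hm A hA, fun ε _ => .of_forall fun i => ⟨A, h i A hA, by simp⟩⟩

/-- A limit in probability of `F i`-measurable variables is measurable for `approxSigma`. -/
lemma measurable_approxSigma {β : Type*} [PseudoMetricSpace β] [MeasurableSpace β] [BorelSpace β]
    {W : Ω → β} (hW : Measurable W)
    (h : ∀ δ : ℝ, 0 < δ → ∀ ε : ℝ≥0∞, ε ≠ 0 → ∀ᶠ i in l, ∃ V : Ω → β, Measurable[F i] V ∧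
      P {ω | δ ≤ dist (V ω) (W ω)} ≤ ε) :
    Measurable[approxSigma P l F] W := by
  refine @measurable_of_isClosed _ _ _ _ _ (approxSigma P l F) _ fun C hC => ?_
  refine ⟨hW hC.measurableSet, fun ε hε => ?_⟩
  -- `{W ∈ C}` is compared with `{dist(V, C) < δ}`, where `δ` is so small that `W` falls into the
  -- `2δ`-neighbourhood of `C` outside `C` with small probability only.
  obtain ⟨δ, hδ, hδε⟩ : ∃ δ : ℝ, 0 < δ ∧ P (W ⁻¹' (Metric.thickening (2 * δ) C \ C)) ≤ ε / 2 := by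
    have h1 : Tendsto (fun k : ℕ => P (W ⁻¹' (Metric.thickening (2 * (1 / ((k : ℝ) + 1))) C \ C)))
        atTop (𝓝 0) := by
      have := tendsto_measure_iInter_atTop (μ := P)
        (s := fun k : ℕ => W ⁻¹' (Metric.thickening (2 * (1 / ((k : ℝ) + 1))) C \ C))
        (fun k => (hW (Metric.isOpen_thickening.measurableSet.diff
          hC.measurableSet)).nullMeasurableSet)
        (fun a b hab => Set.preimage_mono (Set.sdiff_subset_sdiff_left
          (Metric.thickening_mono (by gcongr) _))) ⟨0, measure_ne_top _ _⟩
      have hempty : ⋂ k : ℕ, W ⁻¹' (Metric.thickening (2 * (1 / ((k : ℝ) + 1))) C \ C) = ∅ := by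
        rw [← Set.preimage_iInter]
        suffices hh : ⋂ k : ℕ, (Metric.thickening (2 * (1 / ((k : ℝ) + 1))) C \ C) = ∅ by
          rw [hh, Set.preimage_empty]
        ext x
        simp only [Set.mem_iInter, Set.mem_sdiff, Set.mem_empty_iff_false, iff_false]
        intro hx
        refine (hx 0).2 (hC.closure_eq ▸ ?_)
        rw [Metric.closure_eq_iInter_thickening]
        simp only [Set.mem_iInter]
        intro δ hδ
        obtain ⟨k, hk⟩ := exists_nat_one_div_lt (half_pos hδ)
        exact Metric.thickening_mono (by linarith) _ (hx k).1
      rwa [hempty, measure_empty] at this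
    obtain ⟨k, hk⟩ := (ENNReal.tendsto_nhds_zero.1 h1 (ε / 2) (ENNReal.half_pos hε)).exists
    exact ⟨1 / ((k : ℝ) + 1), by positivity, hk⟩
  filter_upwards [h δ hδ (ε / 2) (ENNReal.half_pos hε).ne'] with i ⟨V, hV, hVW⟩
  refine ⟨V ⁻¹' Metric.thickening δ C, hV Metric.isOpen_thickening.measurableSet, ?_⟩
  have hsub : (W ⁻¹' C) ∆ (V ⁻¹' Metric.thickening δ C) ⊆
      {ω | δ ≤ dist (V ω) (W ω)} ∪ W ⁻¹' (Metric.thickening (2 * δ) C \ C) := by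
    intro ω hω
    simp only [Set.mem_union, Set.mem_ofPred_eq, Set.mem_preimage, Set.mem_sdiff]
    by_cases hd : δ ≤ dist (V ω) (W ω)
    · exact .inl hd
    push Not at hd
    rcases hω with ⟨h1, h2⟩ | ⟨h1, h2⟩
    · exact absurd (Metric.mem_thickening_iff.2 ⟨W ω, h1, hd⟩) h2
    · refine .inr ⟨?_, h2⟩
      obtain ⟨z, hz, hz'⟩ := Metric.mem_thickening_iff.1 h1
      refine Metric.mem_thickening_iff.2 ⟨z, hz, ?_⟩
      linarith [dist_triangle (W ω) (V ω) z, dist_comm (W ω) (V ω)]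
  calc _ ≤ _ := (measure_mono hsub).trans (measure_union_le _ _)
    _ ≤ ε / 2 + ε / 2 := add_le_add hVW hδε
    _ = ε := ENNReal.add_halves ε

lemma measurable_approxSigma_of_ae_eq {β : Type*} [MeasurableSpace β] {V W : Ω → β}
    (hW : Measurable W) (hV : Measurable[approxSigma P l F] V) (h : W =ᵐ[P] V) :
    Measurable[approxSigma P l F] W := fun A hA =>
  measurableSet_approxSigma_of_ae_eq (hW hA) (hV hA) (h.fun_comp (· ∈ A))

/-- `approxSigma` is closed under almost sure limits of sequences. -/
lemma measurable_approxSigma_of_tendsto_ae {β : Type*} [PseudoMetricSpace β]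
    [SecondCountableTopology β] [MeasurableSpace β] [BorelSpace β] {V : ℕ → Ω → β} {W : Ω → β}
    (hW : Measurable W) (hV : ∀ k, Measurable[approxSigma P l F] (V k))
    (h : ∀ᵐ ω ∂P, Tendsto (fun k => V k ω) atTop (𝓝 (W ω))) :
    Measurable[approxSigma P l F] W := by
  have hVm k : Measurable (V k) := (hV k).mono approxSigma_le le_rfl
  have hlim := tendstoInMeasure_of_tendsto_ae (fun k => (hVm k).aestronglyMeasurable) h
  refine Measurable.mono (measurable_approxSigma (l := (⊤ : Filter Unit)) hW
    fun δ hδ ε hε => .of_forall fun _ => ?_) approxSigma_const_approxSigma_le le_rfl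
  have := tendstoInMeasure_iff_dist.1 hlim δ hδ
  obtain ⟨k, hk⟩ := (ENNReal.tendsto_nhds_zero.1 this ε (pos_iff_ne_zero.2 hε)).exists
  exact ⟨V k, hV k, hk⟩

/-- An event that can be approximated by events of `m` agrees almost surely with one of them,
by the Borel-Cantelli lemma. -/
lemma exists_ae_eq_of_measurableSet_approxSigma {m : MeasurableSpace Ω} {A : Set Ω}
    (hA : MeasurableSet[approxSigma (mΩ := mΩ) P (⊤ : Filter Unit) fun _ => m] A) :
    ∃ S, MeasurableSet[m] S ∧ A =ᵐ[P] S := by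
  have h k : ∃ S, MeasurableSet[m] S ∧ P (A ∆ S) ≤ (2⁻¹ : ℝ≥0∞) ^ (k + 1) := by
    obtain ⟨_, hS⟩ := (hA.2 ((2⁻¹ : ℝ≥0∞) ^ (k + 1)) (by simp)).exists
    exact hS
  choose S hS hP using h
  have hsum : ∑' k, P (A ∆ S k) ≠ ∞ := by
    refine ne_top_of_le_ne_top ?_ (ENNReal.tsum_le_tsum hP)
    rw [ENNReal.tsum_geometric_add_one]
    simp
  refine ⟨limsup S atTop, @MeasurableSet.measurableSet_limsup _ m _ hS, ?_⟩
  filter_upwards [ae_eventually_notMem hsum] with ω hω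
  refine propext ?_
  change ω ∈ A ↔ ω ∈ limsup S atTop
  rw [mem_limsup_iff_frequently_mem]
  have : ∀ᶠ k in atTop, (ω ∈ S k ↔ ω ∈ A) := hω.mono fun k hk => by
    rw [Set.mem_symmDiff] at hk; tauto
  rw [frequently_congr this, frequently_const]

end Approximation

/-! ### Conditional independence and conditional expectation -/

section ConditionalExpectation

variable {Ω : Type*} {mΩ : MeasurableSpace Ω} {P : Measure Ω}

/-- Conditional expectation is self-adjoint with respect to multiplication by functions which are
measurable for the conditioning sigma-field. -/
lemma integral_condExp_mul [IsProbabilityMeasure P] {m : MeasurableSpace Ω} (hm : m ≤ mΩ)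
    {f g : Ω → ℝ} (hf : Integrable f P) (hg : StronglyMeasurable[m] g)
    (hfg : Integrable (fun ω => f ω * g ω) P) :
    ∫ ω, (P[f | m]) ω * g ω ∂P = ∫ ω, f ω * g ω ∂P := by
  rw [← integral_condExp hm (f := fun ω => f ω * g ω)]
  exact (integral_congr_ae (condExp_mul_of_stronglyMeasurable_right hg hfg hf)).symm

lemma integrable_indicator_one [IsProbabilityMeasure P] {A : Set Ω} (hA : MeasurableSet A) :
    Integrable (A.indicator fun _ => (1 : ℝ)) P :=
  (integrable_const 1).indicator hA

lemma abs_condExp_indicator_le {m : MeasurableSpace Ω} (A : Set Ω) :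
    ∀ᵐ ω ∂P, |(P[A.indicator (fun _ => (1 : ℝ)) | m]) ω| ≤ 1 := by
  refine ae_bdd_abs_condExp_of_ae_bdd_abs (R := 1) (.of_forall fun ω => ?_)
  by_cases h : ω ∈ A <;> simp [h]

lemma indicator_ae_eq {A S : Set Ω} (h : A =ᵐ[P] S) :
    A.indicator (fun _ => (1 : ℝ)) =ᵐ[P] S.indicator fun _ => (1 : ℝ) :=
  indicator_ae_eq_of_ae_eq_set h

/-- Integrals over the events of a sigma-field are determined by those over a generating
pi-system together with the full integral. -/
lemma setIntegral_eq_of_isPiSystem {m : MeasurableSpace Ω} (hm : m ≤ mΩ) {π : Set (Set Ω)}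
    (hgen : m = MeasurableSpace.generateFrom π) (hπ : IsPiSystem π) {f g : Ω → ℝ}
    (hf : Integrable f P) (hg : Integrable g P) (huniv : ∫ ω, f ω ∂P = ∫ ω, g ω ∂P)
    (h : ∀ t ∈ π, ∫ ω in t, f ω ∂P = ∫ ω in t, g ω ∂P) :
    ∀ T, MeasurableSet[m] T → ∫ ω in T, f ω ∂P = ∫ ω in T, g ω ∂P := by
  refine MeasurableSpace.induction_on_inter hgen hπ (by simp) h ?_ ?_
  · intro T hT ih
    have h1 := integral_add_compl (hm T hT) hf
    have h2 := integral_add_compl (hm T hT) hg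
    linarith
  · intro T hd hT ih
    rw [integral_iUnion (fun i => hm _ (hT i)) hd hf.integrableOn,
      integral_iUnion (fun i => hm _ (hT i)) hd hg.integrableOn]
    exact tsum_congr ih

lemma condExp_ae_eq_condExp_of_le {m m' : MeasurableSpace Ω} (hm : m ≤ m') (hm' : m' ≤ mΩ)
    [SigmaFinite (P.trim hm')] {f g : Ω → ℝ} (h : P[f | m'] =ᵐ[P] g) :
    P[f | m] =ᵐ[P] P[g | m] :=
  (condExp_condExp_of_le hm hm').symm.trans (condExp_congr_ae h)

/-- Suppose that, given `D`, the sigma-field `G` is conditionally independent of `K`. If an event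
of `K` agrees almost surely with an event of `G ⊔ H`, where `H ≤ K`, then it already agrees almost
surely with an event of `D ⊔ H`: the conditional expectations of the event given `G ⊔ H` and given
`D ⊔ H` coincide. -/
lemma exists_ae_eq_of_condIndep [IsProbabilityMeasure P] {G D H K : MeasurableSpace Ω}
    (hG : G ≤ mΩ) (hK : K ≤ mΩ) (hDG : D ≤ G) (hDK : D ≤ K) (hH : H ≤ K)
    (hind : ∀ p, MeasurableSet[G] p → P[p.indicator (fun _ => (1 : ℝ)) | K]
      =ᵐ[P] P[p.indicator (fun _ => (1 : ℝ)) | D])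
    {A S : Set Ω} (hA : MeasurableSet[K] A) (hS : MeasurableSet[G ⊔ H] S) (hAS : A =ᵐ[P] S) :
    ∃ S', MeasurableSet[D ⊔ H] S' ∧ A =ᵐ[P] S' := by
  have hGH : G ⊔ H ≤ mΩ := sup_le hG (hH.trans hK)
  have hDH : D ⊔ H ≤ mΩ := sup_le (hDK.trans hK) (hH.trans hK)
  have hDHK : D ⊔ H ≤ K := sup_le hDK hH
  have hDHG : D ⊔ H ≤ G ⊔ H := sup_le_sup_right hDG H
  have hAm := hK A hA
  set a : Ω → ℝ := A.indicator fun _ => 1 with ha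
  have ha_int : Integrable a P := integrable_indicator_one hAm
  set Q : Ω → ℝ := P[a | D ⊔ H] with hQ
  have hQm : StronglyMeasurable[D ⊔ H] Q := stronglyMeasurable_condExp
  have hQ_int : Integrable Q P := integrable_condExp
  have hbasic : ∀ p q, MeasurableSet[G] p → MeasurableSet[H] q →
      ∫ ω in p ∩ q, Q ω ∂P = ∫ ω in p ∩ q, a ω ∂P := by
    intro p q hp hq
    have hpm := hG p hp
    have hqm := hK q (hH q hq)
    set b : Ω → ℝ := p.indicator fun _ => 1 with hb
    set c : Ω → ℝ := q.indicator fun _ => 1 with hc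
    set u : Ω → ℝ := P[b | D] with hu
    have hb_int : Integrable b P := integrable_indicator_one hpm
    have hcm : StronglyMeasurable[H] c := stronglyMeasurable_const.indicator hq
    have hum : StronglyMeasurable[D] u := stronglyMeasurable_condExp
    have hc_le : ∀ ω, ‖c ω‖ ≤ 1 := fun ω => by by_cases h : ω ∈ q <;> simp [hc, h]
    have hb_le : ∀ ω, ‖b ω‖ ≤ 1 := fun ω => by by_cases h : ω ∈ p <;> simp [hb, h]
    have ha_le : ∀ ω, ‖a ω‖ ≤ 1 := fun ω => by by_cases h : ω ∈ A <;> simp [ha, h]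
    have hset : ∀ f : Ω → ℝ, ∫ ω in p ∩ q, f ω ∂P = ∫ ω, b ω * (c ω * f ω) ∂P := by
      intro f
      rw [← integral_indicator (hpm.inter hqm)]
      congr 1 with ω
      by_cases h1 : ω ∈ p <;> by_cases h2 : ω ∈ q <;> simp [hb, hc, h1, h2]
    -- the expectation of `1_p ξ` is that of `E(1_p | D) ξ`, for `K`-measurable `ξ`
    have key : ∀ ξ : Ω → ℝ, StronglyMeasurable[K] ξ → Integrable ξ P →
        ∫ ω, b ω * ξ ω ∂P = ∫ ω, u ω * ξ ω ∂P := by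
      intro ξ hξ hξi
      rw [← integral_condExp_mul hK hb_int hξ
        (hξi.bdd_mul hb_int.aestronglyMeasurable (.of_forall hb_le))]
      refine integral_congr_ae ?_
      filter_upwards [hind p hp] with ω hω
      rw [hω]
    have hcK : StronglyMeasurable[K] c := hcm.mono hH
    have hcΩ : AEStronglyMeasurable[mΩ] c P := (hcm.mono (hH.trans hK)).aestronglyMeasurable
    rw [hset, hset, key (fun ω => c ω * Q ω) (hcK.mul (hQm.mono hDHK))
        (hQ_int.bdd_mul hcΩ (.of_forall hc_le)),
      key (fun ω => c ω * a ω) (hcK.mul (stronglyMeasurable_const.indicator hA))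
        (ha_int.bdd_mul hcΩ (.of_forall hc_le))]
    have hucm : StronglyMeasurable[D ⊔ H] fun ω => u ω * c ω :=
      (hum.mono le_sup_left).mul (hcm.mono le_sup_right)
    have h1 := integral_condExp_mul hDH ha_int hucm
      (((integrable_condExp (m := D) (f := b)).mul_bdd hcΩ (.of_forall hc_le)).bdd_mul
        ha_int.aestronglyMeasurable (.of_forall ha_le))
    calc ∫ ω, u ω * (c ω * Q ω) ∂P = ∫ ω, Q ω * (u ω * c ω) ∂P := by congr 1 with ω; ring
      _ = ∫ ω, a ω * (u ω * c ω) ∂P := h1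
      _ = ∫ ω, u ω * (c ω * a ω) ∂P := by congr 1 with ω; ring
  have hgen : G ⊔ H = MeasurableSpace.generateFrom
      {t | ∃ p q, MeasurableSet[G] p ∧ MeasurableSet[H] q ∧ p ∩ q = t} := by
    refine le_antisymm (sup_le (fun p hp => ?_) (fun q hq => ?_))
      (MeasurableSpace.generateFrom_le ?_)
    · exact MeasurableSpace.measurableSet_generateFrom
        ⟨p, Set.univ, hp, @MeasurableSet.univ _ H, Set.inter_univ p⟩
    · exact MeasurableSpace.measurableSet_generateFrom
        ⟨Set.univ, q, @MeasurableSet.univ _ G, hq, Set.univ_inter q⟩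
    · rintro _ ⟨p, q, hp, hq, rfl⟩
      exact @MeasurableSet.inter _ (G ⊔ H) _ _ ((le_sup_left : G ≤ G ⊔ H) p hp)
        ((le_sup_right : H ≤ G ⊔ H) q hq)
  have hall : ∀ T, MeasurableSet[G ⊔ H] T → ∫ ω in T, Q ω ∂P = ∫ ω in T, a ω ∂P := by
    refine setIntegral_eq_of_isPiSystem hGH hgen ?_ hQ_int ha_int (integral_condExp hDH) ?_
    · rintro _ ⟨p, q, hp, hq, rfl⟩ _ ⟨p', q', hp', hq', rfl⟩ -
      exact ⟨p ∩ p', q ∩ q', @MeasurableSet.inter _ G _ _ hp hp',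
        @MeasurableSet.inter _ H _ _ hq hq', Set.inter_inter_inter_comm _ _ _ _⟩
    · rintro _ ⟨p, q, hp, hq, rfl⟩
      exact hbasic p q hp hq
  have h1 : Q =ᵐ[P] P[a | G ⊔ H] :=
    ae_eq_condExp_of_forall_setIntegral_eq hGH ha_int (fun _ _ _ => hQ_int.integrableOn)
      (fun T hT _ => hall T hT) (hQm.mono hDHG).aestronglyMeasurable
  have h2 : P[a | G ⊔ H] =ᵐ[P] a := by
    refine (condExp_congr_ae (indicator_ae_eq hAS)).trans ?_
    rw [condExp_of_stronglyMeasurable hGH (stronglyMeasurable_const.indicator hS)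
      (integrable_indicator_one (hGH S hS))]
    exact (indicator_ae_eq hAS).symm
  refine ⟨Q ⁻¹' {1}, hQm.measurable (measurableSet_singleton 1), ?_⟩
  filter_upwards [h1.trans h2] with ω hω
  refine propext ?_
  change ω ∈ A ↔ Q ω = 1
  rw [hω, ha]
  by_cases h : ω ∈ A <;> simp [h]

/-- The conditional expectation is the best approximation in `L²`. -/
lemma integral_sub_condExp_sq_le [IsProbabilityMeasure P] {m : MeasurableSpace Ω} (hm : m ≤ mΩ)
    {X η : Ω → ℝ} (hX : MemLp X 2 P) (hη : MemLp η 2 P) (hηm : StronglyMeasurable[m] η) :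
    ∫ ω, (X ω - (P[X | m]) ω) ^ 2 ∂P ≤ ∫ ω, (X ω - η ω) ^ 2 ∂P := by
  have hY : MemLp (X - η) 2 P := hX.sub hη
  have hc : P[X - η | m] =ᵐ[P] P[X | m] - η := by
    refine (condExp_sub (hX.integrable one_le_two) (hη.integrable one_le_two) m).trans ?_
    rw [condExp_of_stronglyMeasurable hm hηm (hη.integrable one_le_two)]
  have h1 : ∫ ω, (X ω - (P[X | m]) ω) ^ 2 ∂P
      = ∫ ω, ((X - η) ω - (P[X - η | m]) ω) ^ 2 ∂P := by
    refine integral_congr_ae ?_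
    filter_upwards [hc] with ω hω
    rw [hω]
    simp
  have h2 : ∫ ω, ((X - η) ω - (P[X - η | m]) ω) ^ 2 ∂P = ∫ ω, (Var[X - η; P | m]) ω ∂P :=
    (integral_condExp hm).symm
  have h3 : ∫ ω, (P[(X - η) ^ 2 | m]) ω ∂P = ∫ ω, (X ω - η ω) ^ 2 ∂P := integral_condExp hm
  rw [h1, h2, ← h3]
  exact integral_mono_ae integrable_condVar integrable_condExp (condVar_ae_le_condExp_sq hm hY)

lemma integral_sq_eq_eLpNorm_sq {g : Ω → ℝ}
    (hg : MemLp g 2 P) : ∫ ω, g ω ^ 2 ∂P = (eLpNorm g 2 P).toReal ^ 2 := by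
  rw [← integral_congr_ae (.of_forall fun ω => Real.norm_eq_abs (g ω) ▸ sq_abs (g ω)),
    integral_eq_lintegral_of_nonneg_ae (.of_forall fun ω => sq_nonneg _)
      (hg.aestronglyMeasurable.norm.pow 2), ← ENNReal.toReal_pow]
  congr 1
  have h := eLpNorm_nnreal_pow_eq_lintegral (μ := P) (f := g) (p := 2) two_ne_zero
  have h2 : ((2 : NNReal) : ℝ) = ((2 : ℕ) : ℝ) := by norm_num
  rw [h2, ENNReal.rpow_natCast] at h
  simp only [ENNReal.rpow_natCast] at h
  refine Eq.trans (lintegral_congr fun ω => ?_) h.symm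
  rw [ENNReal.ofReal_pow (norm_nonneg _), ofReal_norm]

/-- A variable with values in a standard Borel space, all of whose events agree almost surely with
events of `m`, agrees almost surely with an `m`-measurable variable. -/
lemma exists_measurable_ae_eq [IsProbabilityMeasure P] {E : Type*} [MeasurableSpace E]
    [StandardBorelSpace E] {m : MeasurableSpace Ω} {W : Ω → E}
    (h : ∀ A, MeasurableSet A → ∃ S, MeasurableSet[m] S ∧ W ⁻¹' A =ᵐ[P] S) :
    ∃ Z : Ω → E, Measurable[m] Z ∧ W =ᵐ[P] Z := by
  classical
  have : Nonempty E := ⟨W (nonempty_of_isProbabilityMeasure P).some⟩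
  have hemb : MeasurableEmbedding (MeasurableSpace.mapNatBool E) :=
    (MeasurableSpace.measurable_mapNatBool E).measurableEmbedding
      (MeasurableSpace.injective_mapNatBool E)
  choose S hS hWS using fun k => h _
    (MeasurableSpace.measurableSet_natGeneratingSequence (α := E) k)
  obtain ⟨g, hg, hgE⟩ := hemb.exists_measurable_extend (measurable_id (α := E)) fun _ => this
  let V : Ω → ℕ → Bool := fun ω k => decide (ω ∈ S k)
  have hV : Measurable[m] V := by
    refine @measurable_pi_lambda _ _ _ m _ _ fun k => ?_
    refine @measurable_to_bool _ m _ ?_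
    convert hS k using 1
    ext ω
    simp [V]
  refine ⟨fun ω => g (V ω), hg.comp hV, ?_⟩
  filter_upwards [ae_all_iff.2 hWS] with ω hω
  have : V ω = MeasurableSpace.mapNatBool E (W ω) := by
    funext k
    have := hω k
    change (W ω ∈ MeasurableSpace.natGeneratingSequence E k) = (ω ∈ S k) at this
    simp only [V, MeasurableSpace.mapNatBool]
    exact decide_eq_decide.2 (this ▸ Iff.rfl)
  rw [this]
  exact (congrFun hgE (W ω)).symm

end ConditionalExpectation

/-! ### Time integrals of processes -/

section TimeIntegrals

variable {Ω : Type*} [mΩ : MeasurableSpace Ω]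

/-- A right continuous process is jointly measurable in time and randomness. -/
lemma measurable_uncurry_of_rightContinuous {E : Type*} [TopologicalSpace E]
    [TopologicalSpace.PseudoMetrizableSpace E] [MeasurableSpace E] [BorelSpace E]
    {X : ℝ → Ω → E} (hX : ∀ t, Measurable (X t))
    (hc : ∀ ω t, ContinuousWithinAt (fun s => X s ω) (Set.Ici t) t) :
    Measurable (Function.uncurry X) := by
  let τ : ℕ → ℝ → ℝ := fun k r => ((⌊r * (k + 1)⌋ : ℝ) + 1) / (k + 1)
  refine measurable_of_tendsto_metrizable
    (f := fun (k : ℕ) (p : ℝ × Ω) => X (τ k p.1) p.2) (fun k => ?_) ?_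
  · have h1 : Measurable fun q : ℤ × Ω => X (((q.1 : ℝ) + 1) / (k + 1)) q.2 :=
      measurable_from_prod_countable_right fun i => hX (((i : ℝ) + 1) / (k + 1))
    have h2 : Measurable fun p : ℝ × Ω => ((⌊p.1 * (k + 1)⌋, p.2) : ℤ × Ω) :=
      (Int.measurable_floor.comp (measurable_fst.mul_const _)).prodMk measurable_snd
    exact h1.comp h2
  · refine tendsto_pi_nhds.2 fun ⟨r, ω⟩ => ?_
    have hτ_ge : ∀ k, r ≤ τ k r := fun k => by
      have hk : (0 : ℝ) < k + 1 := by positivity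
      rw [le_div_iff₀ hk]
      exact (Int.lt_floor_add_one _).le
    have hτ_le : ∀ k, τ k r ≤ r + 1 / ((k : ℝ) + 1) := fun k => by
      have hk : (0 : ℝ) < k + 1 := by positivity
      rw [div_le_iff₀ hk, add_mul, one_div_mul_cancel hk.ne']
      linarith [Int.floor_le (r * (k + 1))]
    have hτ : Tendsto (fun k => τ k r) atTop (𝓝 r) :=
      tendsto_of_tendsto_of_tendsto_of_le_of_le tendsto_const_nhds
        (by simpa using tendsto_const_nhds.add (tendsto_one_div_add_atTop_nhds_zero_nat (𝕜 := ℝ)))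
        hτ_ge hτ_le
    exact (hc ω r).tendsto.comp (tendsto_nhdsWithin_iff.2 ⟨hτ, .of_forall hτ_ge⟩)

/-- The integral of a jointly measurable process over a time interval depends measurably on the
end points and on the randomness. -/
lemma measurable_intervalIntegral_param {V : Type*} [NormedAddCommGroup V] [NormedSpace ℝ V]
    [SecondCountableTopology V] [MeasurableSpace V] [BorelSpace V] {Z : ℝ → Ω → V}
    (hZ : Measurable (Function.uncurry Z)) :
    Measurable fun p : ℝ × ℝ × Ω => ∫ r in p.1..p.2.1, Z r p.2.2 := by
  have h : ∀ u v : ℝ × ℝ × Ω → ℝ, Measurable u → Measurable v →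
      Measurable fun p => ∫ r in Set.Ioc (u p) (v p), Z r p.2.2 := by
    intro u v hu hv
    have hs : MeasurableSet {q : (ℝ × ℝ × Ω) × ℝ | u q.1 < q.2 ∧ q.2 ≤ v q.1} :=
      (measurableSet_lt (hu.comp measurable_fst) measurable_snd).inter
        (measurableSet_le measurable_snd (hv.comp measurable_fst))
    have hm : Measurable fun q : (ℝ × ℝ × Ω) × ℝ => Z q.2 q.1.2.2 :=
      hZ.comp (measurable_snd.prodMk (measurable_snd.comp (measurable_snd.comp measurable_fst)))
    have := (hm.indicator hs).stronglyMeasurable.integral_prod_right' (ν := volume)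
    convert this.measurable using 2 with p
    rw [← integral_indicator measurableSet_Ioc]
    rfl
  simp only [intervalIntegral]
  exact (h _ _ measurable_fst (measurable_fst.comp measurable_snd)).sub
    (h _ _ (measurable_fst.comp measurable_snd) measurable_fst)

lemma measurable_intervalIntegral {V : Type*} [NormedAddCommGroup V] [NormedSpace ℝ V]
    [SecondCountableTopology V] [MeasurableSpace V] [BorelSpace V] {Z : ℝ → Ω → V}
    (hZ : Measurable (Function.uncurry Z)) (a b : ℝ) :
    Measurable fun ω => ∫ r in a..b, Z r ω :=
  (measurable_intervalIntegral_param hZ).comp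
    (measurable_const.prodMk (measurable_const.prodMk measurable_id))

variable {P : Measure Ω} [IsProbabilityMeasure P]

/-- For a bounded jointly measurable process `Z` which is adapted to `m` on `]a, b]`, the time
integral `W` of `Z` is almost surely equal to `E(W | m)`. No progressive measurability is needed:
by Fubini's theorem, `E(1_A W) = E(E(1_A | m) W)` for every event `A`. -/
lemma ae_eq_condExp_integral_of_bounded {Z : ℝ → Ω → ℝ} {a b : ℝ} (hab : a ≤ b)
    (hZ : Measurable (Function.uncurry Z)) {C : ℝ} (hC : ∀ r ω, |Z r ω| ≤ C) :
    ∀ m : MeasurableSpace Ω, m ≤ mΩ → (∀ r ∈ Set.Ioc a b, Measurable[m] (Z r)) →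
      (fun ω => ∫ r in a..b, Z r ω) =ᵐ[P] P[fun ω => ∫ r in a..b, Z r ω | m] := by
  set W : Ω → ℝ := fun ω => ∫ r in a..b, Z r ω with hW
  have hWm : Measurable W := measurable_intervalIntegral hZ a b
  have hW_le : ∀ ω, ‖W ω‖ ≤ C * |b - a| := fun ω =>
    intervalIntegral.norm_integral_le_of_norm_le_const fun r _ => hC r ω
  have hW_int : Integrable W P :=
    Integrable.of_bound hWm.aestronglyMeasurable _ (.of_forall hW_le)
  have hZΩ : ∀ r, AEStronglyMeasurable (Z r) P := fun r =>
    (hZ.comp (measurable_prodMk_left (x := r))).aestronglyMeasurable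
  have hswap : ∀ f : Ω → ℝ, Integrable f P →
      ∫ ω, f ω * W ω ∂P = ∫ r in Set.Ioc a b, ∫ ω, f ω * Z r ω ∂P := by
    intro f hf
    have h1 : Integrable (Function.uncurry fun ω r => f ω * Z r ω)
        (P.prod (volume.restrict (Set.Ioc a b))) := by
      have h2 := hf.comp_fst (volume.restrict (Set.Ioc a b))
      exact h2.mul_bdd (c := C) ((hZ.comp measurable_swap).aestronglyMeasurable)
        (.of_forall fun p => hC p.2 p.1)
    rw [← integral_integral_swap h1]
    refine integral_congr_ae (.of_forall fun ω => ?_)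
    simp only [hW, intervalIntegral.integral_of_le hab, integral_const_mul]
  intro m hm hZm
  refine Integrable.ae_eq_of_forall_setIntegral_eq _ _ hW_int integrable_condExp fun A hA _ => ?_
  set α : Ω → ℝ := A.indicator fun _ => 1 with hα
  have hα_int : Integrable α P := integrable_indicator_one hA
  have hα_le : ∀ ω, ‖α ω‖ ≤ 1 := fun ω => by by_cases h : ω ∈ A <;> simp [hα, h]
  have hset : ∀ f : Ω → ℝ, ∫ ω in A, f ω ∂P = ∫ ω, α ω * f ω ∂P := by
    intro f
    rw [← integral_indicator hA]
    congr 1 with ω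
    by_cases h : ω ∈ A <;> simp [hα, h]
  have hmid : ∫ ω, α ω * W ω ∂P = ∫ ω, (P[α | m]) ω * W ω ∂P := by
    rw [hswap _ hα_int, hswap _ integrable_condExp]
    refine setIntegral_congr_fun measurableSet_Ioc fun r hr => ?_
    exact (integral_condExp_mul hm hα_int (hZm r hr).stronglyMeasurable
      (hα_int.mul_bdd (hZΩ r) (.of_forall fun ω => hC r ω))).symm
  have h3 : ∫ ω, (P[W | m]) ω * (P[α | m]) ω ∂P = ∫ ω, W ω * (P[α | m]) ω ∂P :=
    integral_condExp_mul hm hW_int stronglyMeasurable_condExp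
      (integrable_condExp.bdd_mul hW_int.aestronglyMeasurable (.of_forall hW_le))
  have h4 : ∫ ω, (P[α | m]) ω * (P[W | m]) ω ∂P = ∫ ω, α ω * (P[W | m]) ω ∂P :=
    integral_condExp_mul hm hα_int stronglyMeasurable_condExp
      (integrable_condExp.bdd_mul hα_int.aestronglyMeasurable (.of_forall hα_le))
  rw [hset, hset, hmid, ← h4]
  simp only [mul_comm] at h3 ⊢
  rw [← h3]

variable {ι : Type*} {l : Filter ι} {F : ι → MeasurableSpace Ω}

lemma measurable_approxSigma_intervalIntegral_real {Z : ℝ → Ω → ℝ} {a b : ℝ} (hab : a ≤ b)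
    (hZ : Measurable (Function.uncurry Z))
    (hZm : ∀ r ∈ Set.Ioc a b, Measurable[approxSigma P l F] (Z r))
    (hint : ∀ᵐ ω ∂P, IntervalIntegrable (fun r => Z r ω) volume a b) :
    Measurable[approxSigma P l F] fun ω => ∫ r in a..b, Z r ω := by
  let c : ℕ → ℝ → ℝ := fun k x => max (-(k : ℝ)) (min x k)
  have hcm : ∀ k, Measurable (c k) := fun k => by fun_prop
  have hc_le : ∀ k x, |c k x| ≤ k := fun k x => by
    have hk : (0 : ℝ) ≤ k := k.cast_nonneg
    exact abs_le.2 ⟨le_max_left _ _, max_le (by linarith) (min_le_right _ _)⟩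
  have hc_le' : ∀ k x, |c k x| ≤ |x| := fun k x => by
    have hk : (0 : ℝ) ≤ k := k.cast_nonneg
    rcases abs_cases x with h | h <;>
    exact abs_le.2 ⟨le_max_of_le_right (le_min (by linarith) (by linarith)),
      max_le (by linarith) ((min_le_left _ _).trans (le_abs_self x |>.trans (by linarith)))⟩
  have hc_lim : ∀ x, Tendsto (fun k => c k x) atTop (𝓝 x) := fun x => by
    refine tendsto_const_nhds.congr' ?_
    obtain ⟨N, hN⟩ := exists_nat_ge |x|
    filter_upwards [eventually_ge_atTop N] with k hk
    have : |x| ≤ k := hN.trans (by exact_mod_cast hk)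
    obtain ⟨h1, h2⟩ := abs_le.1 this
    simp only [c]
    rw [min_eq_left h2, max_eq_right h1]
  refine measurable_approxSigma_of_tendsto_ae (measurable_intervalIntegral hZ a b)
    (V := fun k ω => ∫ r in a..b, c k (Z r ω)) (fun k => ?_) ?_
  · have hZk : Measurable (Function.uncurry fun r ω => c k (Z r ω)) := (hcm k).comp hZ
    exact measurable_approxSigma_of_ae_eq (measurable_intervalIntegral hZk a b)
      stronglyMeasurable_condExp.measurable
      (ae_eq_condExp_integral_of_bounded hab hZk (fun r ω => hc_le k _) _ approxSigma_le
        fun r hr => (hcm k).comp (hZm r hr))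
  · filter_upwards [hint] with ω hω
    refine intervalIntegral.tendsto_integral_filter_of_dominated_convergence
      (fun r => ‖Z r ω‖) (.of_forall fun k => ?_) (.of_forall fun k => .of_forall fun r _ => ?_)
      hω.norm (.of_forall fun r _ => hc_lim _)
    · exact ((hcm k).comp (hZ.comp measurable_prodMk_right)).aestronglyMeasurable
    · exact hc_le' k _

/-- The time integral of a process which is adapted to a complete sigma-field is measurable with
respect to that sigma-field. -/
lemma measurable_approxSigma_intervalIntegral {n : ℕ} {Z : ℝ → Ω → EuclideanSpace ℝ (Fin n)}
    {a b : ℝ} (hab : a ≤ b) (hZ : Measurable (Function.uncurry Z))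
    (hZm : ∀ r ∈ Set.Ioc a b, Measurable[approxSigma P l F] (Z r))
    (hint : ∀ᵐ ω ∂P, IntervalIntegrable (fun r => Z r ω) volume a b) :
    Measurable[approxSigma P l F] fun ω => ∫ r in a..b, Z r ω := by
  let e := EuclideanSpace.equiv (Fin n) ℝ
  have h : Measurable[approxSigma P l F] fun ω i => ∫ r in a..b, Z r ω i := by
    refine @measurable_pi_lambda _ _ _ (approxSigma P l F) _ _ fun i => ?_
    have hi : Measurable fun x : EuclideanSpace ℝ (Fin n) => x i :=
      (EuclideanSpace.proj i : _ →L[ℝ] ℝ).measurable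
    refine measurable_approxSigma_intervalIntegral_real hab (hi.comp hZ)
      (fun r hr => hi.comp (hZm r hr)) ?_
    filter_upwards [hint] with ω hω
    exact ⟨(EuclideanSpace.proj i : _ →L[ℝ] ℝ).integrable_comp hω.1,
      (EuclideanSpace.proj i : _ →L[ℝ] ℝ).integrable_comp hω.2⟩
  refine measurable_approxSigma_of_ae_eq (measurable_intervalIntegral hZ a b)
    (e.symm.continuous.measurable.comp h) ?_
  filter_upwards [hint] with ω hω
  refine e.injective (funext fun i => ?_)
  simp only [Function.comp_apply, ContinuousLinearEquiv.apply_symm_apply]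
  exact ((EuclideanSpace.proj i : _ →L[ℝ] ℝ).intervalIntegral_comp_comm hω).symm

end TimeIntegrals

/-! ### The signal and its noisy observations -/

lemma measurable_sigmaOn {Ω F : Type*} [MeasurableSpace F] (Z : ℝ → Ω → F) {I : Set ℝ} {s : ℝ}
    (hs : s ∈ I) : Measurable[sigmaOn Z I] (Z s) :=
  (comap_measurable (Z s)).mono (le_iSup₂ (f := fun s (_ : s ∈ I) =>
    MeasurableSpace.comap (Z s) inferInstance) s hs) le_rfl

lemma sigmaOn_le_of_forall {Ω F : Type*} [MeasurableSpace F] {Z : ℝ → Ω → F} {I : Set ℝ}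
    {m : MeasurableSpace Ω} (h : ∀ s ∈ I, Measurable[m] (Z s)) : sigmaOn Z I ≤ m :=
  iSup₂_le fun s hs => (h s hs).comap_le

namespace FilteringModel

instance {Ω E : Type*} [MeasurableSpace Ω] [TopologicalSpace E] [MeasurableSpace E] {n : ℕ}
    (M : FilteringModel Ω E n) : IsProbabilityMeasure M.P := M.isProbabilityMeasure

section GeneralStateSpace

variable {Ω E : Type*} [MeasurableSpace Ω] [TopologicalSpace E] [MeasurableSpace E] {n : ℕ}
  (M : FilteringModel Ω E n)

lemma measurable_path (r : ℝ) : Measurable fun ω t => M.X (t + r) ω :=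
  measurable_pi_lambda _ fun t => M.measurable_X (t + r)

lemma measure_shift (r : ℝ) {T : Set (ℝ → E)} (hT : MeasurableSet T) :
    M.P {ω | (fun t => M.X (t + r) ω) ∈ T} = M.P {ω | (fun t => M.X t ω) ∈ T} := by
  have h := congrArg (fun μ => μ T) (M.stationary r)
  rwa [Measure.map_apply (M.measurable_path r) hT, Measure.map_apply
    (by simpa using M.measurable_path 0) hT] at h

lemma stationaryLaw_apply {A : Set E} (hA : MeasurableSet A) :
    M.stationaryLaw A = M.P (M.X 0 ⁻¹' A) :=
  Measure.map_apply (M.measurable_X 0) hA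

lemma map_X (r : ℝ) : M.P.map (M.X r) = M.stationaryLaw := by
  ext A hA
  rw [M.stationaryLaw_apply hA, Measure.map_apply (M.measurable_X r) hA]
  have h := M.measure_shift r (measurable_pi_apply (0 : ℝ) hA)
  simp only [Set.mem_preimage, zero_add] at h
  exact h

instance : IsProbabilityMeasure M.stationaryLaw :=
  Measure.isProbabilityMeasure_map (M.measurable_X 0).aemeasurable

/-- If the events of `X_0` are determined by the past noiseless observations up to time `0`,
then, by stationarity, the events of `X_t` are determined by those up to time `t`. -/
lemma exists_ae_eq_of_zero
    (h : ∀ A : Set E, MeasurableSet A →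
      ∃ S, MeasurableSet[M.sigmaHX (Set.Iic 0)] S ∧ M.X 0 ⁻¹' A =ᵐ[M.P] S)
    (t : ℝ) {A : Set E} (hA : MeasurableSet A) :
    ∃ S, MeasurableSet[M.sigmaHX (Set.Iic t)] S ∧ M.X t ⁻¹' A =ᵐ[M.P] S := by
  obtain ⟨S, hS, hAS⟩ := h A hA
  have hHle : sigmaOn (fun s (x : ℝ → E) => M.h (x s)) (Set.Iic 0)
      ≤ MeasurableSpace.pi :=
    sigmaOn_le (fun s => M.measurable_h.comp (measurable_pi_apply s)) _
  have hcomap : M.sigmaHX (Set.Iic 0) =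
      (sigmaOn (fun s (x : ℝ → E) => M.h (x s)) (Set.Iic 0)).comap
        (fun ω t => M.X t ω) := by
    simp only [sigmaHX, sigmaOn, MeasurableSpace.comap_iSup, MeasurableSpace.comap_comp]
    rfl
  rw [hcomap] at hS
  obtain ⟨T, hT, rfl⟩ := hS
  have hshift : Measurable[M.sigmaHX (Set.Iic t),
      sigmaOn (fun s (x : ℝ → E) => M.h (x s)) (Set.Iic 0)]
      fun ω s => M.X (s + t) ω := by
    refine Measurable.of_comap_le ?_
    simp only [sigmaOn, MeasurableSpace.comap_iSup, MeasurableSpace.comap_comp]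
    refine iSup₂_le fun s hs => ?_
    exact (measurable_sigmaOn (fun s ω => M.h (M.X s ω))
      (show s + t ∈ Set.Iic t by simpa using hs)).comap_le
  refine ⟨(fun ω s => M.X (s + t) ω) ⁻¹' T, hshift hT, ?_⟩
  have hev : MeasurableSet (((fun x : ℝ → E => x 0) ⁻¹' A) ∆ T) :=
    (measurable_pi_apply (0 : ℝ) hA).symmDiff (hHle _ hT)
  rw [← measure_symmDiff_eq_zero_iff] at hAS ⊢
  have := M.measure_shift t hev
  rw [← hAS]
  convert this using 2 <;>
  · ext ω
    simp [Set.mem_symmDiff]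

lemma ae_intervalIntegrable :
    ∀ᵐ ω ∂M.P, ∀ a b, IntervalIntegrable (fun s => M.h (M.X s ω)) volume a b := by
  filter_upwards [M.locallyIntegrable] with ω hω a b
  exact (hω.integrableOn_isCompact isCompact_uIcc).intervalIntegrable

lemma Y_sub_ae_eq (κ a b : ℝ) : (fun ω => M.Y κ b ω - M.Y κ a ω) =ᵐ[M.P]
    fun ω => (∫ s in a..b, M.h (M.X s ω)) + κ • (M.B b ω - M.B a ω) := by
  filter_upwards [M.ae_intervalIntegrable] with ω hω
  rw [Y, Y, ← intervalIntegral.integral_interval_sub_left (hω 0 b) (hω 0 a), smul_sub]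
  abel

/-- The sigma-field of the noise. -/
def sigmaB : MeasurableSpace Ω := MeasurableSpace.comap (fun ω t => M.B t ω) inferInstance

/-- The sigma-field of the whole signal. -/
def sigmaX : MeasurableSpace Ω := MeasurableSpace.comap (fun ω t => M.X t ω) inferInstance

lemma sigmaB_le : M.sigmaB ≤ ‹MeasurableSpace Ω› :=
  (measurable_pi_lambda _ M.wiener.measurable).comap_le

lemma sigmaX_le : M.sigmaX ≤ ‹MeasurableSpace Ω› :=
  (measurable_pi_lambda _ M.measurable_X).comap_le

lemma measurable_sigmaB (t : ℝ) : Measurable[M.sigmaB] (M.B t) :=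
  (measurable_pi_apply t).comp (comap_measurable fun ω t => M.B t ω)

lemma measurable_sigmaX (t : ℝ) : Measurable[M.sigmaX] (M.X t) :=
  (measurable_pi_apply t).comp (comap_measurable fun ω t => M.X t ω)

lemma sigmaHX_le_sigmaX (I : Set ℝ) : M.sigmaHX I ≤ M.sigmaX :=
  sigmaOn_le_of_forall fun s _ => M.measurable_h.comp (M.measurable_sigmaX s)

lemma Pμ_preimage {μ : Measure E} [IsProbabilityMeasure μ] (hμ : μ ≪ M.stationaryLaw) {A : Set E}
    (hA : MeasurableSet A) : M.Pμ μ (M.X 0 ⁻¹' A) = μ A := by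
  rw [Pμ, withDensity_apply _ (M.measurable_X 0 hA),
    ← setLIntegral_map hA (Measure.measurable_rnDeriv _ _) (M.measurable_X 0)]
  change ∫⁻ x in A, μ.rnDeriv M.stationaryLaw x ∂M.stationaryLaw = μ A
  rw [← withDensity_apply _ hA, Measure.withDensity_rnDeriv_eq _ _ hμ]

lemma pastLaw_apply {μ : Measure E} [IsProbabilityMeasure μ] (hμ : μ ≪ M.stationaryLaw) {A : Set E}
    (hA : MeasurableSet A) {S : Set Ω} (hS : MeasurableSet[M.sigmaHX (Set.Iic 0)] S)
    (hAS : M.X 0 ⁻¹' A =ᵐ[M.P] S) : M.pastLaw μ S = μ A := by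
  rw [pastLaw, trim_measurableSet_eq _ hS, ← M.Pμ_preimage hμ hA]
  exact (measure_congr ((withDensity_absolutelyContinuous _ _).ae_le hAS)).symm

/-- An event of the past observations which is null under the law started from `π(· | A)` is
disjoint from `{X_0 ∈ A}`, up to a null set. -/
lemma measure_inter_eq_zero_of_pastLaw_cond {A : Set E} (hA : MeasurableSet A)
    (hA0 : M.stationaryLaw A ≠ 0) {S : Set Ω} (hS : MeasurableSet[M.sigmaHX (Set.Iic 0)] S)
    (h : M.pastLaw (M.stationaryLaw[|A]) S = 0) : M.P (M.X 0 ⁻¹' A ∩ S) = 0 := by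
  have hprob := cond_isProbabilityMeasure hA0
  have hd := Measure.measurable_rnDeriv (M.stationaryLaw[|A]) M.stationaryLaw
  have hpos := Measure.rnDeriv_pos (cond_absolutelyContinuous (μ := M.stationaryLaw) (s := A))
  rw [pastLaw, trim_measurableSet_eq _ hS, Pμ,
    withDensity_apply_eq_zero (show Measurable fun ω =>
      (M.stationaryLaw[|A]).rnDeriv M.stationaryLaw (M.X 0 ω) from
        hd.comp (M.measurable_X 0))] at h
  have hN : M.stationaryLaw
      (A ∩ {x | ¬ 0 < (M.stationaryLaw[|A]).rnDeriv M.stationaryLaw x}) = 0 := by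
    have h1 : M.stationaryLaw[{x | ¬ 0 < (M.stationaryLaw[|A]).rnDeriv M.stationaryLaw x}|A] = 0 :=
      hpos
    rw [cond_apply hA, mul_eq_zero] at h1
    exact h1.resolve_left (ENNReal.inv_ne_zero.2 (measure_ne_top _ _))
  have hN' : M.P (M.X 0 ⁻¹'
      (A ∩ {x | ¬ 0 < (M.stationaryLaw[|A]).rnDeriv M.stationaryLaw x})) = 0 := by
    exact (M.stationaryLaw_apply (hA.inter
      (measurableSet_lt measurable_const hd).compl)).symm.trans hN
  refine measure_mono_null (fun ω hω => ?_) (measure_union_null hN' h)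
  by_cases hω' : 0 < (M.stationaryLaw[|A]).rnDeriv M.stationaryLaw (M.X 0 ω)
  · exact .inr ⟨hω'.ne', hω.2⟩
  · exact .inl ⟨hω.1, hω'⟩

/-! ### The Markov property -/

lemma comap_X_le_sigmaOn {s : ℝ} {I : Set ℝ} (hs : s ∈ I) :
    MeasurableSpace.comap (M.X s) inferInstance ≤ sigmaOn M.X I :=
  (measurable_sigmaOn M.X hs).comap_le

lemma sigmaOn_X_le (I : Set ℝ) : sigmaOn M.X I ≤ ‹MeasurableSpace Ω› :=
  sigmaOn_le M.measurable_X I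

/-- The Markov property for events which depend on the signal at finitely many times, all after
`s`. The induction removes the earliest of these times. -/
lemma condExp_cylinder (J : Finset ℝ) (B : ℝ → Set E) (hB : ∀ t ∈ J, MeasurableSet (B t)) :
    ∀ s : ℝ, (∀ t ∈ J, s ≤ t) →
      M.P[(⋂ t ∈ J, M.X t ⁻¹' B t).indicator (fun _ => (1 : ℝ)) | sigmaOn M.X (Set.Iic s)]
        =ᵐ[M.P] M.P[(⋂ t ∈ J, M.X t ⁻¹' B t).indicator (fun _ => (1 : ℝ)) |
          MeasurableSpace.comap (M.X s) inferInstance] := by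
  induction J using Finset.induction_on_min with
  | empty =>
    intro s _
    simp only [Finset.notMem_empty, Set.iInter_of_empty, Set.iInter_univ, Set.indicator_univ]
    rw [condExp_const (M.sigmaOn_X_le _), condExp_const (M.measurable_X s).comap_le]
  | insert a J haJ ih =>
    intro s hs
    have hsa : s ≤ a := hs a (Finset.mem_insert_self _ _)
    set C : Set Ω := ⋂ t ∈ J, M.X t ⁻¹' B t with hC
    have hCm : MeasurableSet C := Finset.measurableSet_biInter _ fun t ht =>
      M.measurable_X t (hB t (Finset.mem_insert_of_mem ht))
    have hBa : MeasurableSet (B a) := hB a (Finset.mem_insert_self _ _)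
    have ih' := ih (fun t ht => hB t (Finset.mem_insert_of_mem ht)) a fun t ht => (haJ t ht).le
    obtain ⟨g, hg, hgX⟩ := Measurable.exists_eq_measurable_comp
      (stronglyMeasurable_condExp (m := MeasurableSpace.comap (M.X a) inferInstance) (μ := M.P)
        (f := C.indicator fun _ => (1 : ℝ))).measurable
    -- the one-step function, truncated in order to be bounded everywhere
    let φ : E → ℝ := (B a).indicator fun x => max (-1) (min (g x) 1)
    have hφ : Measurable φ :=
      (measurable_const.max (hg.min measurable_const)).indicator hBa
    have hφ_le : ∀ x, |φ x| ≤ 1 := fun x => by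
      by_cases hx : x ∈ B a
      · simp only [φ, Set.indicator_of_mem hx]
        exact abs_le.2 ⟨le_max_left _ _, max_le (by norm_num) (min_le_right _ _)⟩
      · simp [φ, Set.indicator_of_notMem hx]
    have hsplit : (⋂ t ∈ insert a J, M.X t ⁻¹' B t).indicator (fun _ => (1 : ℝ)) =
        (M.X a ⁻¹' B a).indicator (C.indicator fun _ => (1 : ℝ)) := by
      rw [Set.indicator_indicator, Finset.set_biInter_insert]
    have hstep : M.P[(⋂ t ∈ insert a J, M.X t ⁻¹' B t).indicator (fun _ => (1 : ℝ)) |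
        sigmaOn M.X (Set.Iic a)] =ᵐ[M.P] fun ω => φ (M.X a ω) := by
      rw [hsplit]
      refine (condExp_indicator (integrable_indicator_one hCm)
        (measurable_sigmaOn M.X (Set.self_mem_Iic (a := a)) hBa)).trans ?_
      filter_upwards [ih', abs_condExp_indicator_le (P := M.P)
        (m := MeasurableSpace.comap (M.X a) inferInstance) C] with ω hω hω1
      by_cases hx : M.X a ω ∈ B a
      · rw [hgX] at hω1
        obtain ⟨h1, h2⟩ := abs_le.1 hω1
        simp only [Function.comp_apply] at h1 h2
        rw [Set.indicator_of_mem (show ω ∈ M.X a ⁻¹' B a from hx), hω, hgX]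
        simp only [φ, Set.indicator_of_mem hx, Function.comp_apply]
        rw [min_eq_left h2, max_eq_right h1]
      · rw [Set.indicator_of_notMem (show ω ∉ M.X a ⁻¹' B a from hx)]
        simp only [φ, Set.indicator_of_notMem hx]
    have hmono : sigmaOn M.X (Set.Iic s) ≤ sigmaOn M.X (Set.Iic a) :=
      sigmaOn_le_of_forall fun r hr => measurable_sigmaOn M.X (show r ∈ Set.Iic a from hr.trans hsa)
    exact (condExp_ae_eq_condExp_of_le hmono (M.sigmaOn_X_le _) hstep).trans
      ((M.markov s a hsa φ hφ ⟨1, hφ_le⟩).trans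
        (condExp_ae_eq_condExp_of_le (M.comap_X_le_sigmaOn (I := Set.Iic a) hsa) (M.sigmaOn_X_le _)
          hstep).symm)

/-- The Markov property, in its symmetric form: given the present, the past is independent of the
future. -/
lemma condExp_past_eq (s : ℝ) {p : Set Ω} (hp : MeasurableSet[sigmaOn M.X (Set.Iic s)] p) :
    M.P[p.indicator (fun _ => (1 : ℝ)) | sigmaOn M.X (Set.Ici s)] =ᵐ[M.P]
      M.P[p.indicator (fun _ => (1 : ℝ)) | MeasurableSpace.comap (M.X s) inferInstance] := by
  have hpast := M.sigmaOn_X_le (Set.Iic s)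
  have hfut := M.sigmaOn_X_le (Set.Ici s)
  have hpres := (M.measurable_X s).comap_le
  have hpm := hpast p hp
  set b : Ω → ℝ := p.indicator fun _ => 1 with hb
  have hb_int : Integrable b M.P := integrable_indicator_one hpm
  have hb_le : ∀ ω, ‖b ω‖ ≤ 1 := fun ω => by by_cases h : ω ∈ p <;> simp [hb, h]
  refine (ae_eq_condExp_of_forall_setIntegral_eq hfut hb_int
    (fun _ _ _ => integrable_condExp.integrableOn) (fun T hT _ => ?_)
    (stronglyMeasurable_condExp.mono
      (M.comap_X_le_sigmaOn Set.self_mem_Ici)).aestronglyMeasurable).symm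
  refine setIntegral_eq_of_isPiSystem hfut
    (generateFrom_piiUnionInter_measurableSet (fun t => MeasurableSpace.comap (M.X t) inferInstance)
      (Set.Ici s)).symm
    (isPiSystem_piiUnionInter _ (fun t => @MeasurableSpace.isPiSystem_measurableSet _ (_)) _)
    integrable_condExp hb_int (integral_condExp hpres) ?_ T hT
  rintro _ ⟨J, hJ, f, hf, rfl⟩
  choose! B hB hBf using hf
  have hcyl : ⋂ t ∈ J, f t = ⋂ t ∈ J, M.X t ⁻¹' B t :=
    Set.iInter₂_congr fun t ht => (hBf t ht).symm
  rw [hcyl]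
  set C : Set Ω := ⋂ t ∈ J, M.X t ⁻¹' B t with hC
  have hCm : MeasurableSet C :=
    Finset.measurableSet_biInter _ fun t ht => M.measurable_X t (hB t ht)
  set c : Ω → ℝ := C.indicator fun _ => 1 with hc
  have hc_int : Integrable c M.P := integrable_indicator_one hCm
  have hc_le : ∀ ω, ‖c ω‖ ≤ 1 := fun ω => by by_cases h : ω ∈ C <;> simp [hc, h]
  have hset : ∀ ξ : Ω → ℝ, ∫ ω in C, ξ ω ∂M.P = ∫ ω, c ω * ξ ω ∂M.P := fun ξ => by
    rw [← integral_indicator hCm]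
    congr 1 with ω
    by_cases h : ω ∈ C <;> simp [hc, h]
  have hmarkov : M.P[c | sigmaOn M.X (Set.Iic s)] =ᵐ[M.P]
      M.P[c | MeasurableSpace.comap (M.X s) inferInstance] :=
    M.condExp_cylinder J B hB s fun t ht => hJ ht
  set u : Ω → ℝ := M.P[b | MeasurableSpace.comap (M.X s) inferInstance] with hu
  set v : Ω → ℝ := M.P[c | MeasurableSpace.comap (M.X s) inferInstance] with hv
  rw [hset, hset]
  calc ∫ ω, c ω * u ω ∂M.P = ∫ ω, v ω * u ω ∂M.P :=
        (integral_condExp_mul hpres hc_int stronglyMeasurable_condExp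
          (integrable_condExp.bdd_mul hc_int.aestronglyMeasurable (.of_forall hc_le))).symm
    _ = ∫ ω, u ω * v ω ∂M.P := by simp only [mul_comm]
    _ = ∫ ω, b ω * v ω ∂M.P := integral_condExp_mul hpres hb_int stronglyMeasurable_condExp
          (integrable_condExp.bdd_mul hb_int.aestronglyMeasurable (.of_forall hb_le))
    _ = ∫ ω, v ω * b ω ∂M.P := by simp only [mul_comm]
    _ = ∫ ω, (M.P[c | sigmaOn M.X (Set.Iic s)]) ω * b ω ∂M.P :=
        integral_congr_ae (hmarkov.mono fun ω hω => congrArg (· * b ω) hω.symm)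
    _ = ∫ ω, c ω * b ω ∂M.P := integral_condExp_mul hpast hc_int
        (stronglyMeasurable_const.indicator hp)
        (hb_int.bdd_mul hc_int.aestronglyMeasurable (.of_forall hc_le))

end GeneralStateSpace

/-! ### Recovery of the noiseless observations -/

variable {Ω E : Type*} [MeasurableSpace Ω] [TopologicalSpace E] [PolishSpace E]
  [MeasurableSpace E] [BorelSpace E] {n : ℕ} (M : FilteringModel Ω E n)

/-- The event `{X_δ ∈ A}` converges to `{X_0 ∈ A}` in probability as `δ ↓ 0`, for every measurable
`A`; by stationarity the same holds at every time, from the left as well as from the right. For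
continuous functions of `X` in place of indicators this follows from right continuity, and these
are dense in `L¹(π)`. -/
lemma tendsto_measure_symmDiff {A : Set E} (hA : MeasurableSet A) :
    Tendsto (fun δ => M.P ((M.X δ ⁻¹' A) ∆ (M.X 0 ⁻¹' A))) (𝓝[≥] 0) (𝓝 0) := by
  let _ := TopologicalSpace.upgradeIsCompletelyMetrizable E
  rw [ENNReal.tendsto_nhds_zero]
  intro ε hε
  have h3 : ε / 3 ≠ 0 := ENNReal.div_ne_zero.2 ⟨hε.ne', by simp⟩
  obtain ⟨g, hg, -⟩ := (integrable_indicator_one (P := M.stationaryLaw)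
    hA).exists_boundedContinuous_lintegral_sub_le h3
  set a : E → ℝ := A.indicator fun _ => 1 with ha
  have ham : Measurable a := measurable_const.indicator hA
  have hgm : Measurable g := g.continuous.measurable
  have hga : ∀ r, ∫⁻ ω, ‖a (M.X r ω) - g (M.X r ω)‖ₑ ∂M.P ≤ ε / 3 := fun r => by
    rw [← lintegral_map (f := fun x => ‖a x - g x‖ₑ) (ham.sub hgm).enorm (M.measurable_X r),
      M.map_X r]
    exact hg
  have hlim : Tendsto (fun δ => ∫⁻ ω, ‖g (M.X δ ω) - g (M.X 0 ω)‖ₑ ∂M.P) (𝓝[≥] 0) (𝓝 0) := by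
    have := tendsto_lintegral_filter_of_dominated_convergence (μ := M.P) (l := 𝓝[≥] (0 : ℝ))
      (F := fun δ ω => ‖g (M.X δ ω) - g (M.X 0 ω)‖ₑ) (f := fun _ => 0)
      (fun _ => ENNReal.ofReal (2 * ‖g‖))
      (.of_forall fun δ => ((hgm.comp (M.measurable_X δ)).sub
        (hgm.comp (M.measurable_X 0))).enorm)
      (.of_forall fun δ => .of_forall fun ω => by
        rw [← ofReal_norm]
        refine ENNReal.ofReal_le_ofReal ((norm_sub_le _ _).trans ?_)
        linarith [g.norm_coe_le_norm (M.X δ ω), g.norm_coe_le_norm (M.X 0 ω)])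
      (by
        rw [lintegral_const]
        exact ENNReal.mul_ne_top ENNReal.ofReal_ne_top (measure_ne_top _ _))
      (.of_forall fun ω => by
        have h1 : Tendsto (fun δ => g (M.X δ ω)) (𝓝[≥] 0) (𝓝 (g (M.X 0 ω))) :=
          (g.continuous.tendsto _).comp (M.cadlag ω 0).1.tendsto
        have h2 := (h1.sub_const (g (M.X 0 ω))).enorm
        simpa using h2)
    simpa using this
  filter_upwards [ENNReal.tendsto_nhds_zero.1 hlim (ε / 3) (pos_iff_ne_zero.2 h3)] with δ hδ
  calc M.P ((M.X δ ⁻¹' A) ∆ (M.X 0 ⁻¹' A))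
      = ∫⁻ ω, ((M.X δ ⁻¹' A) ∆ (M.X 0 ⁻¹' A)).indicator 1 ω ∂M.P :=
        (lintegral_indicator_one ((M.measurable_X δ hA).symmDiff (M.measurable_X 0 hA))).symm
    _ ≤ ∫⁻ ω, (‖a (M.X δ ω) - g (M.X δ ω)‖ₑ + ‖g (M.X δ ω) - g (M.X 0 ω)‖ₑ
          + ‖a (M.X 0 ω) - g (M.X 0 ω)‖ₑ) ∂M.P := by
        refine lintegral_mono fun ω => ?_
        have htri : ‖a (M.X δ ω) - a (M.X 0 ω)‖ₑ ≤ ‖a (M.X δ ω) - g (M.X δ ω)‖ₑ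
            + ‖g (M.X δ ω) - g (M.X 0 ω)‖ₑ + ‖a (M.X 0 ω) - g (M.X 0 ω)‖ₑ := by
          have : a (M.X δ ω) - a (M.X 0 ω) = (a (M.X δ ω) - g (M.X δ ω))
            + (g (M.X δ ω) - g (M.X 0 ω)) - (a (M.X 0 ω) - g (M.X 0 ω)) := by ring
          rw [this]
          exact enorm_sub_le.trans (add_le_add_left (enorm_add_le _ _) _)
        refine le_trans ?_ htri
        by_cases h1 : M.X δ ω ∈ A <;> by_cases h2 : M.X 0 ω ∈ A <;>
          simp [ha, h1, h2, Set.indicator, Set.mem_symmDiff]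
    _ = (∫⁻ ω, ‖a (M.X δ ω) - g (M.X δ ω)‖ₑ ∂M.P)
          + (∫⁻ ω, ‖g (M.X δ ω) - g (M.X 0 ω)‖ₑ ∂M.P)
          + ∫⁻ ω, ‖a (M.X 0 ω) - g (M.X 0 ω)‖ₑ ∂M.P := by
        have m1 := M.measurable_X δ
        have m2 := M.measurable_X 0
        rw [lintegral_add_left (by fun_prop), lintegral_add_left (by fun_prop)]
    _ ≤ ε / 3 + ε / 3 + ε / 3 := add_le_add (add_le_add (hga δ) hδ) (hga 0)
    _ = ε := ENNReal.add_thirds ε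

lemma measurable_uncurry_hX : Measurable (Function.uncurry fun s ω => M.h (M.X s ω)) :=
  M.measurable_h.comp (measurable_uncurry_of_rightContinuous M.measurable_X
    fun ω t => (M.cadlag ω t).1)

lemma measurable_Y (κ t : ℝ) : Measurable (M.Y κ t) :=
  (measurable_intervalIntegral M.measurable_uncurry_hX 0 t).add
    ((M.wiener.measurable t).const_smul κ)

lemma sigmaYPast_le (κ b : ℝ) : M.sigmaYPast κ b ≤ ‹MeasurableSpace Ω› :=
  iSup₂_le fun a _ => sigmaOn_le (fun s => (M.measurable_Y κ s).sub (M.measurable_Y κ a)) _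

/-- The events which can be recovered from the noisy observations up to time `0` with vanishing
error probability as `κ ↓ 0`. -/
noncomputable def limitSigma : MeasurableSpace Ω :=
  approxSigma M.P (𝓝[>] 0) fun κ => M.sigmaYPast κ 0

lemma measurable_limitSigma_integral {a b : ℝ} (ha : a < 0) (hab : a ≤ b) (hb : b ≤ 0) :
    Measurable[M.limitSigma] fun ω => ∫ s in a..b, M.h (M.X s ω) := by
  refine measurable_approxSigma (measurable_intervalIntegral M.measurable_uncurry_hX a b) ?_
  intro δ hδ ε hε
  -- the noise `B_b - B_a` exceeds a suitable level `N` with probability at most `ε`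
  obtain ⟨N, hN⟩ : ∃ N : ℕ, M.P {ω | (N : ℝ) ≤ ‖M.B b ω - M.B a ω‖} ≤ ε := by
    have hm : Measurable fun ω => ‖M.B b ω - M.B a ω‖ :=
      ((M.wiener.measurable b).sub (M.wiener.measurable a)).norm
    have h1 := tendsto_measure_iInter_atTop (μ := M.P)
      (s := fun N : ℕ => {ω | (N : ℝ) ≤ ‖M.B b ω - M.B a ω‖})
      (fun N => (measurableSet_le measurable_const hm).nullMeasurableSet)
      (fun i j hij ω hω => le_trans (Nat.cast_le (α := ℝ).2 hij) hω) ⟨0, measure_ne_top _ _⟩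
    have h2 : ⋂ N : ℕ, {ω | (N : ℝ) ≤ ‖M.B b ω - M.B a ω‖} = ∅ := by
      ext ω
      simp only [Set.mem_iInter, Set.mem_ofPred_eq, Set.mem_empty_iff_false, iff_false, not_forall,
        not_le]
      exact exists_nat_gt _
    rw [h2, measure_empty] at h1
    exact (ENNReal.tendsto_nhds_zero.1 h1 ε (pos_iff_ne_zero.2 hε)).exists
  have hκ : ∀ᶠ κ : ℝ in 𝓝[>] 0, κ * N < δ := by
    have : Tendsto (fun κ : ℝ => κ * N) (𝓝[>] 0) (𝓝 (0 * N)) :=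
      (tendsto_id.mono_left nhdsWithin_le_nhds).mul_const _
    rw [zero_mul] at this
    exact this.eventually_lt_const hδ
  filter_upwards [hκ, self_mem_nhdsWithin] with κ hκN hκ0
  refine ⟨fun ω => M.Y κ b ω - M.Y κ a ω, ?_, (measure_mono_ae ?_).trans hN⟩
  · exact (measurable_sigmaOn (fun s ω => M.Y κ s ω - M.Y κ a ω)
      (I := Set.Icc a 0) ⟨hab, hb⟩).mono
      (le_iSup₂ (f := fun a (_ : a ∈ Set.Iio (0 : ℝ)) => M.sigmaY κ a 0) a ha) le_rfl
  · filter_upwards [M.Y_sub_ae_eq κ a b] with ω hω hδω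
    change δ ≤ dist (M.Y κ b ω - M.Y κ a ω) _ at hδω
    change (N : ℝ) ≤ _
    rw [hω, dist_eq_norm, add_sub_cancel_left, norm_smul,
      Real.norm_of_nonneg (le_of_lt hκ0)] at hδω
    have : κ * N < κ * ‖M.B b ω - M.B a ω‖ := hκN.trans_le hδω
    exact (lt_of_mul_lt_mul_left this (le_of_lt hκ0)).le

/-- By Lebesgue's differentiation theorem and Fubini's theorem, `h(X_u)` is the limit of the
difference quotients of the integrated signal for almost every `u`. -/
lemma ae_measurable_limitSigma_hX :
    ∀ᵐ u : ℝ, u < 0 → Measurable[M.limitSigma] fun ω => M.h (M.X u ω) := by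
  let D : ℕ → ℝ × Ω → EuclideanSpace ℝ (Fin n) := fun k p =>
    ((k : ℝ) + 1) • ∫ s in (p.1 - 1 / ((k : ℝ) + 1))..p.1, M.h (M.X s p.2)
  have hD : ∀ k, Measurable (D k) := fun k =>
    ((measurable_intervalIntegral_param M.measurable_uncurry_hX).comp
      ((measurable_fst.sub_const _).prodMk (measurable_fst.prodMk measurable_snd))).const_smul
        ((k : ℝ) + 1)
  have hset : MeasurableSet {p : ℝ × Ω | Tendsto (fun k => D k (p.1, p.2)) atTop
      (𝓝 (M.h (M.X p.1 p.2)))} :=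
    measurableSet_tendsto_fun hD M.measurable_uncurry_hX
  have hae : ∀ᵐ ω ∂M.P, ∀ᵐ u : ℝ, Tendsto (fun k => D k (u, ω)) atTop (𝓝 (M.h (M.X u ω))) := by
    filter_upwards [M.locallyIntegrable, M.ae_intervalIntegrable] with ω hω hω'
    filter_upwards [LocallyIntegrable.ae_hasDerivAt_integral hω] with u hu
    have hlim : Tendsto (fun k : ℕ => u - 1 / ((k : ℝ) + 1)) atTop (𝓝[≠] u) := by
      refine tendsto_nhdsWithin_iff.2 ⟨?_, .of_forall fun k => ?_⟩
      · simpa using tendsto_const_nhds.sub (tendsto_one_div_add_atTop_nhds_zero_nat (𝕜 := ℝ))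
      · have : (0 : ℝ) < 1 / ((k : ℝ) + 1) := by positivity
        simp only [Set.mem_compl_iff, Set.mem_singleton_iff]
        linarith
    refine ((hu 0).tendsto_slope.comp hlim).congr fun k => ?_
    have hk : ((k : ℝ) + 1) ≠ 0 := by positivity
    simp only [Function.comp_apply, slope, vsub_eq_sub, D]
    rw [← neg_sub (∫ t in (0 : ℝ)..u, M.h (M.X t ω)),
      intervalIntegral.integral_interval_sub_left (hω' _ _) (hω' _ _), sub_sub_cancel_left,
      inv_neg, smul_neg, neg_smul, neg_neg, one_div, inv_inv]
  have hae' : ∀ᵐ u : ℝ, ∀ᵐ ω ∂M.P, Tendsto (fun k => D k (u, ω)) atTop (𝓝 (M.h (M.X u ω))) :=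
    (Measure.ae_ae_comm (p := fun (u : ℝ) ω => Tendsto (fun k => D k (u, ω)) atTop
      (𝓝 (M.h (M.X u ω)))) hset).2 hae
  filter_upwards [hae'] with u hu hu0
  have hDm : ∀ k, Measurable[M.limitSigma] fun ω => D k (u, ω) := fun k => by
    have hk : (0 : ℝ) < 1 / ((k : ℝ) + 1) := by positivity
    have hI := M.measurable_limitSigma_integral (a := u - 1 / ((k : ℝ) + 1)) (by linarith)
      (by linarith) hu0.le
    have hc : Measurable fun x : EuclideanSpace ℝ (Fin n) => ((k : ℝ) + 1) • x :=
      (continuous_const_smul _).measurable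
    exact hc.comp hI
  exact measurable_approxSigma_of_tendsto_ae (V := fun k ω => D k (u, ω))
    (M.measurable_h.comp (M.measurable_X u)) hDm hu

/-- In the limit `κ ↓ 0`, the noisy observations determine the noiseless ones. -/
lemma sigmaHX_le_limitSigma : M.sigmaHX (Set.Iic 0) ≤ M.limitSigma := by
  refine sigmaOn_le_of_forall fun r hr C hC => ?_
  have hA := M.measurable_h hC
  refine approxSigma_const_approxSigma_le _ ⟨M.measurable_X r hA,
    fun ε hε => .of_forall fun _ => ?_⟩
  have h1 := ENNReal.tendsto_nhds_zero.1 (M.tendsto_measure_symmDiff hA) ε (pos_iff_ne_zero.2 hε)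
  obtain ⟨δ, hδ, hδε⟩ := mem_nhdsGE_iff_exists_Ico_subset.1 h1
  -- almost every time is good, so there are good times `u < r` arbitrarily close to `r`
  obtain ⟨u, hu, hur⟩ : ∃ u, (u < 0 → Measurable[M.limitSigma] fun ω => M.h (M.X u ω)) ∧
      u ∈ Set.Ioo (r - δ) r := by
    by_contra! hcon
    have h0 : volume (Set.Ioo (r - δ) r) = 0 :=
      measure_mono_null (fun u hu hgood => hcon u hgood hu) M.ae_measurable_limitSigma_hX
    rw [Real.volume_Ioo, ENNReal.ofReal_eq_zero] at h0
    have : (0 : ℝ) < δ := hδ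
    linarith
  refine ⟨M.X u ⁻¹' (M.h ⁻¹' C), hu (hur.2.trans_le hr) hC, ?_⟩
  have h2 : M.P ((M.X (r - u) ⁻¹' (M.h ⁻¹' C)) ∆ (M.X 0 ⁻¹' (M.h ⁻¹' C))) ≤ ε :=
    hδε ⟨by linarith [hur.2], by linarith [hur.1]⟩
  have h3 := M.measure_shift u
    ((measurable_pi_apply (r - u) hA).symmDiff (measurable_pi_apply (0 : ℝ) hA))
  refine le_trans (le_of_eq ?_) h2
  convert h3 using 2 <;>
  · ext ω
    simp [Set.mem_symmDiff]

/-- Stable invertibility, in terms of events and by stationarity only for time `0`. -/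
lemma stablyInvertible_iff : M.StablyInvertible ↔ ∀ A : Set E, MeasurableSet A →
    ∃ S, MeasurableSet[M.sigmaHX (Set.Iic 0)] S ∧ M.X 0 ⁻¹' A =ᵐ[M.P] S := by
  refine ⟨fun h A hA => ?_, fun h t => exists_measurable_ae_eq fun A hA =>
    M.exists_ae_eq_of_zero h t hA⟩
  obtain ⟨Z, hZ, hXZ⟩ := h 0
  exact ⟨Z ⁻¹' A, hZ hA, hXZ.fun_comp (· ∈ A)⟩

/-! ### Stable invertibility and maximal accuracy -/

/-- If `X_0` is recoverable as `κ ↓ 0`, then every `f(X_0)` in `L²` is approximated in `L²` by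
functions of the noisy observations. -/
lemma eventually_exists_eLpNorm_sub_le (h : Measurable[M.limitSigma] (M.X 0)) {f : E → ℝ}
    (hf : MemLp f 2 M.stationaryLaw) {ε : ℝ≥0∞} (hε : ε ≠ 0) :
    ∀ᶠ κ in 𝓝[>] (0 : ℝ), ∃ η : Ω → ℝ, StronglyMeasurable[M.sigmaYPast κ 0] η ∧ MemLp η 2 M.P ∧
      eLpNorm (fun ω => f (M.X 0 ω) - η ω) 2 M.P ≤ ε := by
  let Good : (E → ℝ) → Prop := fun f => AEStronglyMeasurable f M.stationaryLaw ∧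
    ∀ ε : ℝ≥0∞, ε ≠ 0 → ∀ᶠ κ in 𝓝[>] (0 : ℝ), ∃ η : Ω → ℝ,
      StronglyMeasurable[M.sigmaYPast κ 0] η ∧ MemLp η 2 M.P ∧
      eLpNorm (fun ω => f (M.X 0 ω) - η ω) 2 M.P ≤ ε
  have hX0 := (M.measurable_X 0).aemeasurable (μ := M.P)
  have hcomp : ∀ f : E → ℝ, AEStronglyMeasurable f M.stationaryLaw →
      AEStronglyMeasurable (fun ω => f (M.X 0 ω)) M.P := fun f hf => hf.comp_aemeasurable hX0
  have hind : ∀ (c : ℝ) ⦃s : Set E⦄, MeasurableSet s → Good (s.indicator fun _ => c) := by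
    intro c s hs
    refine ⟨(measurable_const.indicator hs).aestronglyMeasurable, fun ε hε => ?_⟩
    have h0 : ε / (‖c‖ₑ + 1) ≠ 0 := ENNReal.div_ne_zero.2 ⟨hε, by simp⟩
    have h0' : (ε / (‖c‖ₑ + 1)) ^ 2 ≠ 0 := pow_ne_zero 2 h0
    filter_upwards [(measurableSet_approxSigma_iff.1 (h hs)).2 _ h0'] with κ ⟨S, hS, hPS⟩
    have hSm := M.sigmaYPast_le κ 0 S hS
    refine ⟨S.indicator fun _ => c, stronglyMeasurable_const.indicator hS,
      memLp_indicator_const 2 hSm c (.inr (measure_ne_top _ _)), ?_⟩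
    have hle : ∀ ω, ‖s.indicator (fun _ => c) (M.X 0 ω) - S.indicator (fun _ => c) ω‖ ≤
        ‖((M.X 0 ⁻¹' s) ∆ S).indicator (fun _ => c) ω‖ := fun ω => by
      by_cases h1 : M.X 0 ω ∈ s <;> by_cases h2 : ω ∈ S <;>
        simp [h1, h2, Set.indicator, Set.mem_symmDiff]
    calc _ ≤ eLpNorm (((M.X 0 ⁻¹' s) ∆ S).indicator fun _ => c) 2 M.P := eLpNorm_mono hle
      _ ≤ ‖c‖ₑ * M.P ((M.X 0 ⁻¹' s) ∆ S) ^ (1 / (2 : ℝ≥0∞).toReal) :=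
          eLpNorm_indicator_const_le c 2
      _ ≤ (‖c‖ₑ + 1) * ((ε / (‖c‖ₑ + 1)) ^ 2) ^ (1 / (2 : ℝ≥0∞).toReal) := by
          gcongr
          exact le_self_add
      _ = (‖c‖ₑ + 1) * (ε / (‖c‖ₑ + 1)) := by
          rw [← ENNReal.rpow_natCast, ← ENNReal.rpow_mul]
          simp
      _ ≤ ε := ENNReal.mul_div_le
  have hadd : ∀ f g, Good f → Good g → Good (f + g) := by
    refine fun f g hf hg => ⟨hf.1.add hg.1, fun ε hε => ?_⟩
    have hε2 := (ENNReal.half_pos hε).ne'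
    filter_upwards [hf.2 _ hε2, hg.2 _ hε2] with κ ⟨η, hη, hηL, hηε⟩ ⟨ζ, hζ, hζL, hζε⟩
    refine ⟨η + ζ, hη.add hζ, hηL.add hζL, ?_⟩
    calc eLpNorm (fun ω => (f + g) (M.X 0 ω) - (η + ζ) ω) 2 M.P
        = eLpNorm ((fun ω => f (M.X 0 ω) - η ω) + fun ω => g (M.X 0 ω) - ζ ω) 2 M.P := by
          congr 1 with ω
          simp only [Pi.add_apply]
          ring
      _ ≤ ε / 2 + ε / 2 := (eLpNorm_add_le ((hcomp f hf.1).sub hηL.1) ((hcomp g hg.1).sub hζL.1)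
          one_le_two).trans (add_le_add hηε hζε)
      _ = ε := ENNReal.add_halves ε
  have hε2 := (ENNReal.half_pos hε).ne'
  obtain ⟨g, hfg, hg⟩ := hf.induction_dense ENNReal.ofNat_ne_top Good
    (fun c s hs _ ε _ => ⟨s.indicator fun _ => c, by simp, hind c hs⟩) hadd (fun _ h => h.1) hε2
  filter_upwards [hg.2 _ hε2] with κ ⟨η, hη, hηL, hηε⟩
  refine ⟨η, hη, hηL, ?_⟩
  have hfgX : eLpNorm (fun ω => (f - g) (M.X 0 ω)) 2 M.P ≤ ε / 2 := by
    have := eLpNorm_map_measure (p := 2) (g := f - g) (hf.1.sub hg.1) hX0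
    exact this.symm.trans_le hfg
  calc eLpNorm (fun ω => f (M.X 0 ω) - η ω) 2 M.P
      = eLpNorm ((fun ω => (f - g) (M.X 0 ω)) + fun ω => g (M.X 0 ω) - η ω) 2 M.P := by
        congr 1 with ω
        simp only [Pi.add_apply, Pi.sub_apply]
        ring
    _ ≤ ε / 2 + ε / 2 := (eLpNorm_add_le (hcomp _ (hf.1.sub hg.1)) ((hcomp g hg.1).sub hηL.1)
        one_le_two).trans (add_le_add hfgX hηε)
    _ = ε := ENNReal.add_halves ε

lemma StablyInvertible.achievesMaximalAccuracy (h : M.StablyInvertible) :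
    M.AchievesMaximalAccuracy := by
  have hX0 : Measurable[M.limitSigma] (M.X 0) := fun A hA => by
    obtain ⟨S, hS, hAS⟩ := M.stablyInvertible_iff.1 h A hA
    exact measurableSet_approxSigma_of_ae_eq (M.measurable_X 0 hA)
      (M.sigmaHX_le_limitSigma S hS) hAS
  intro f hf
  have hfX : MemLp (fun ω => f (M.X 0 ω)) 2 M.P :=
    hf.comp_measurePreserving ⟨M.measurable_X 0, rfl⟩
  rw [Metric.tendsto_nhds]
  intro ε hε
  have hs : (0 : ℝ) < Real.sqrt (ε / 2) := Real.sqrt_pos.2 (half_pos hε)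
  filter_upwards [M.eventually_exists_eLpNorm_sub_le hX0 hf
    (ENNReal.ofReal_pos.2 hs).ne'] with κ ⟨η, hη, hηL, hηε⟩
  have h0 : 0 ≤ M.stationaryError f κ := integral_nonneg fun _ => sq_nonneg _
  rw [Real.dist_0_eq_abs, abs_of_nonneg h0]
  calc M.stationaryError f κ ≤ ∫ ω, (f (M.X 0 ω) - η ω) ^ 2 ∂M.P :=
        integral_sub_condExp_sq_le (M.sigmaYPast_le κ 0) hfX hηL hη
    _ = (eLpNorm (fun ω => f (M.X 0 ω) - η ω) 2 M.P).toReal ^ 2 :=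
        integral_sq_eq_eLpNorm_sq (hfX.sub hηL)
    _ ≤ Real.sqrt (ε / 2) ^ 2 := by
        gcongr
        exact ENNReal.toReal_le_of_le_ofReal hs.le hηε
    _ < ε := by rw [Real.sq_sqrt (half_pos hε).le]; exact half_lt_self hε

/-- For fixed `κ`, the noisy observations are functions of the noise and of the noiseless ones, up
to null sets. -/
lemma sigmaYPast_le_approxSigma (κ : ℝ) : M.sigmaYPast κ 0 ≤
    approxSigma M.P (⊤ : Filter Unit) fun _ => M.sigmaB ⊔ M.sigmaHX (Set.Iic 0) := by
  have hle : M.sigmaB ⊔ M.sigmaHX (Set.Iic 0) ≤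
      approxSigma M.P (⊤ : Filter Unit) fun _ => M.sigmaB ⊔ M.sigmaHX (Set.Iic 0) :=
    le_approxSigma (sup_le M.sigmaB_le (M.sigmaHX_le _)) fun _ => le_rfl
  refine iSup₂_le fun a ha => sigmaOn_le_of_forall fun s hs => ?_
  refine measurable_approxSigma_of_ae_eq ((M.measurable_Y κ s).sub (M.measurable_Y κ a)) ?_
    (M.Y_sub_ae_eq κ a s)
  have h1 := measurable_approxSigma_intervalIntegral (P := M.P) (l := (⊤ : Filter Unit))
    (F := fun _ => M.sigmaB ⊔ M.sigmaHX (Set.Iic 0)) hs.1 M.measurable_uncurry_hX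
    (fun r hr => (measurable_sigmaOn (fun s ω => M.h (M.X s ω))
      (show r ∈ Set.Iic (0 : ℝ) from hr.2.trans hs.2)).mono (le_sup_right.trans hle) le_rfl)
    (M.ae_intervalIntegrable.mono fun ω hω => hω a s)
  have h2 : Measurable[M.sigmaB] fun ω => κ • (M.B s ω - M.B a ω) := by
    have hc : Measurable fun x : EuclideanSpace ℝ (Fin n) => κ • x :=
      (continuous_const_smul κ).measurable
    exact hc.comp ((M.measurable_sigmaB s).sub (M.measurable_sigmaB a))
  exact h1.add (h2.mono (le_sup_left.trans hle) le_rfl)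

/-- If the filter achieves maximal accuracy, then the events of `X_0` are determined by the noise
and the noiseless observations; by independence, the noise does not contribute. -/
lemma AchievesMaximalAccuracy.stablyInvertible (h : M.AchievesMaximalAccuracy) :
    M.StablyInvertible := by
  refine M.stablyInvertible_iff.2 fun A hA => ?_
  have ham : Measurable (A.indicator fun _ => (1 : ℝ)) := measurable_const.indicator hA
  have haL : MemLp (A.indicator fun _ => (1 : ℝ)) 2 M.stationaryLaw :=
    memLp_indicator_const 2 hA 1 (.inr (measure_ne_top _ _))
  have haX : MemLp (fun ω => A.indicator (fun _ => (1 : ℝ)) (M.X 0 ω)) 2 M.P :=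
    haL.comp_measurePreserving ⟨M.measurable_X 0, rfl⟩
  have hmeas : Measurable[approxSigma M.P (⊤ : Filter Unit) fun _ =>
      M.sigmaB ⊔ M.sigmaHX (Set.Iic 0)] fun ω => A.indicator (fun _ => (1 : ℝ)) (M.X 0 ω) := by
    refine Measurable.mono (measurable_approxSigma (l := (⊤ : Filter Unit))
      (ham.comp (M.measurable_X 0)) fun δ hδ ε hε => .of_forall fun _ => ?_)
      approxSigma_const_approxSigma_le le_rfl
    -- Chebyshev's inequality, for `κ` with `e(1_A, κ) < δ² min(ε, 1)`
    have hε' : 0 < (min ε 1).toReal := ENNReal.toReal_pos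
      (by simp [hε]) (ne_top_of_le_ne_top ENNReal.one_ne_top (min_le_right _ _))
    have hpos : 0 < δ ^ 2 * (min ε 1).toReal := by positivity
    obtain ⟨κ, hκ⟩ := ((h _ haL).eventually_lt_const hpos).exists
    refine ⟨M.P[fun ω => A.indicator (fun _ => (1 : ℝ)) (M.X 0 ω) | M.sigmaYPast κ 0],
      stronglyMeasurable_condExp.measurable.mono (M.sigmaYPast_le_approxSigma κ) le_rfl, ?_⟩
    have hcheb := mul_meas_ge_le_integral_of_nonneg (μ := M.P)
      (f := fun ω => (A.indicator (fun _ => (1 : ℝ)) (M.X 0 ω) -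
        (M.P[fun ω => A.indicator (fun _ => (1 : ℝ)) (M.X 0 ω) | M.sigmaYPast κ 0]) ω) ^ 2)
      (.of_forall fun _ => sq_nonneg _) (haX.sub (haX.condExp one_le_two)).integrable_sq (δ ^ 2)
    have hlt := lt_of_mul_lt_mul_left (hcheb.trans_lt hκ) (sq_nonneg δ)
    refine le_trans (measure_mono fun ω hω => ?_) ((ENNReal.toReal_le_toReal (measure_ne_top M.P _)
      (ne_top_of_le_ne_top ENNReal.one_ne_top (min_le_right ε 1))).1 hlt.le |>.trans
        (min_le_left _ _))
    have hω' : δ ≤ dist _ _ := hω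
    rw [dist_comm, Real.dist_eq] at hω'
    exact (pow_le_pow_left₀ hδ.le hω' 2).trans_eq (sq_abs _)
  have hset : MeasurableSet[approxSigma M.P (⊤ : Filter Unit) fun _ =>
      M.sigmaB ⊔ M.sigmaHX (Set.Iic 0)] (M.X 0 ⁻¹' A) := by
    convert hmeas (measurableSet_singleton 1) using 1
    ext ω
    by_cases hω : M.X 0 ω ∈ A <;> simp [hω]
  obtain ⟨S, hS, hAS⟩ := exists_ae_eq_of_measurableSet_approxSigma hset
  obtain ⟨S', hS', hAS'⟩ := exists_ae_eq_of_condIndep M.sigmaB_le M.sigmaX_le bot_le bot_le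
    (M.sigmaHX_le_sigmaX _) (fun p hp => by
      rw [condExp_bot]
      exact condExp_indep_eq M.sigmaB_le M.sigmaX_le (stronglyMeasurable_const.indicator hp)
        M.indep.symm) (M.measurable_sigmaX 0 hA) hS hAS
  rw [bot_sup_eq] at hS'
  exact ⟨S', hS', hAS'⟩

/-! ### Stable invertibility and strong reconstructibility -/

lemma StablyInvertible.stronglyReconstructible (h : M.StablyInvertible) :
    M.StronglyReconstructible := by
  intro μ ν _ _ hμ hν hμν
  obtain ⟨A, hA, hμA, hνA⟩ := hμν
  obtain ⟨S, hS, hAS⟩ := M.stablyInvertible_iff.1 h A hA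
  refine ⟨S, hS, ?_, ?_⟩
  · rw [M.pastLaw_apply hμ hA hS hAS, hμA]
  · rw [M.pastLaw_apply hν hA.compl hS.compl hAS.compl, hνA]

lemma StablyInvertible.reconstructible (h : M.StablyInvertible) : M.Reconstructible := by
  intro μ ν _ _ hμ hν hne heq
  refine hne (Measure.ext fun A hA => ?_)
  obtain ⟨S, hS, hAS⟩ := M.stablyInvertible_iff.1 h A hA
  rw [← M.pastLaw_apply hμ hA hS hAS, heq, M.pastLaw_apply hν hA hS hAS]

/-- An event which is null under the past law started from `π(· | A)` and has a null complement
under the one started from `π(· | Aᶜ)` is a version of `{X_0 ∉ A}`. -/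
lemma StronglyReconstructible.stablyInvertible (h : M.StronglyReconstructible) :
    M.StablyInvertible := by
  refine M.stablyInvertible_iff.2 fun A hA => ?_
  by_cases hA0 : M.stationaryLaw A = 0
  · refine ⟨∅, @MeasurableSet.empty _ (_), ?_⟩
    rw [ae_eq_empty, ← M.stationaryLaw_apply hA, hA0]
  by_cases hA1 : M.stationaryLaw Aᶜ = 0
  · refine ⟨Set.univ, @MeasurableSet.univ _ (_), ?_⟩
    rw [ae_eq_univ, ← Set.preimage_compl, ← M.stationaryLaw_apply hA.compl, hA1]
  have hac : M.stationaryLaw[|A] ⟂ₘ M.stationaryLaw[|Aᶜ] := by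
    refine ⟨Aᶜ, hA.compl, ?_, ?_⟩
    · rw [cond_apply hA, Set.inter_compl_self, measure_empty, mul_zero]
    · rw [cond_apply hA.compl, Set.inter_compl_self, measure_empty, mul_zero]
  obtain ⟨S, hS, hS1, hS2⟩ := h _ _ (cond_isProbabilityMeasure hA0) (cond_isProbabilityMeasure hA1)
    cond_absolutelyContinuous cond_absolutelyContinuous hac
  have h1 := M.measure_inter_eq_zero_of_pastLaw_cond hA hA0 hS hS1
  have h2 := M.measure_inter_eq_zero_of_pastLaw_cond hA.compl hA1 hS.compl hS2
  refine ⟨Sᶜ, hS.compl, ?_⟩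
  rw [← measure_symmDiff_eq_zero_iff]
  refine measure_mono_null (fun ω hω => ?_) (measure_union_null h1 h2)
  simp only [Set.mem_symmDiff, Set.mem_union, Set.mem_inter_iff, Set.mem_preimage,
    Set.mem_compl_iff] at hω ⊢
  tauto

/-! ### Invertibility -/

lemma StablyInvertible.invertible (h : M.StablyInvertible) : M.Invertible := by
  intro s t hst
  refine exists_measurable_ae_eq fun A hA => ?_
  obtain ⟨S, hS, hAS⟩ := M.exists_ae_eq_of_zero (M.stablyInvertible_iff.1 h) t hA
  have hle : M.sigmaHX (Set.Iic t) ≤ sigmaOn M.X (Set.Iic s) ⊔ M.sigmaHX (Set.Icc s t) := by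
    refine sigmaOn_le_of_forall fun r hr => ?_
    rcases le_total r s with hrs | hrs
    · exact (M.measurable_h.comp (measurable_sigmaOn M.X (show r ∈ Set.Iic s from hrs))).mono
        le_sup_left le_rfl
    · exact (measurable_sigmaOn (fun s ω => M.h (M.X s ω))
        (show r ∈ Set.Icc s t from ⟨hrs, hr⟩)).mono le_sup_right le_rfl
  exact exists_ae_eq_of_condIndep (M.sigmaOn_X_le _) (M.sigmaOn_X_le (Set.Ici s))
    (M.comap_X_le_sigmaOn Set.self_mem_Iic) (M.comap_X_le_sigmaOn Set.self_mem_Ici)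
    (sigmaOn_le_of_forall fun r hr => M.measurable_h.comp
      (measurable_sigmaOn M.X (show r ∈ Set.Ici s from hr.1)))
    (fun p hp => M.condExp_past_eq s hp) (measurable_sigmaOn M.X (show t ∈ Set.Ici s from hst) hA)
    (hle S hS) hAS

end FilteringModel
end MaxAccuracy

theorem theorem3p1 {Ω E : Type*} [MeasurableSpace Ω] [TopologicalSpace E] [PolishSpace E]
    [MeasurableSpace E] [BorelSpace E] {n : ℕ} (M : MaxAccuracy.FilteringModel Ω E n) :
    List.TFAE [M.AchievesMaximalAccuracy, M.StablyInvertible, M.StronglyReconstructible] ∧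
      (M.AchievesMaximalAccuracy ∨ M.StablyInvertible ∨ M.StronglyReconstructible →
        M.Invertible ∧ M.Reconstructible) := by
  have h12 : M.AchievesMaximalAccuracy → M.StablyInvertible := fun h => h.stablyInvertible
  have h32 : M.StronglyReconstructible → M.StablyInvertible := fun h => h.stablyInvertible
  refine ⟨?_, fun h => ?_⟩
  · tfae_have 1 → 2 := h12
    tfae_have 2 → 1 := fun h => h.achievesMaximalAccuracy
    tfae_have 2 → 3 := fun h => h.stronglyReconstructible
    tfae_have 3 → 2 := h32
    tfae_finish
  · have h2 : M.StablyInvertible := h.elim h12 fun h => h.elim id h32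
    exact ⟨h2.invertible, h2.reconstructible⟩
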